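/- **Theorem (Josefson–Nissenzweig).** Let $X$ be a Banach space over $\mathbb K\in\{\mathbb R,\mathbb C\}$ with dual space $X'$. (1) If $X$ is infinite-dimensional, there are $x'_1,x'_2,\ldots$ in $X'$ with $\|x'_n\|=1$ for all $n$ and $x'_n(x)\to 0$ for every $x\in X$. (2) Say that a sequence $(y'_n)$ is obtained from $(x'_n)$ by *blocking* if there are finite sets $A_1,A_2,\ldots\subset\mathbb N$, every element of $A_m$ being smaller than every element of $A_n$ for $m<n$, and scalars $a_k\in\mathbb K$ such that $\sum_{k\in A_n}|a_k|=1$ and $y'_n=\sum_{k\in A_n}a_kx'_k$ for every $n$. A *Banach limit* is a functional $L\in(\ell^\infty)'$ with $L((1,1,\ldots))=1=\|L\|$ and $L((t_1,t_2,\ldots))=L((t_2,t_3,\ldots))$ for every $(t_n)\in\ell^\infty$. Let $\lambda_1=(1,-1,1,-1,\ldots)$, $\lambda_2=(1,1,-1,-1,1,1,\ldots)$ and in general, for $n\ge 1$, let $\lambda_n\in\ell^\infty$ be the sequence whose $m$-th term is $(-1)^{\lfloor (m-1)/2^{n-1}\rfloor}$ ($m\ge1$). Suppose that $(x'_n)$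 is a sequence in $X'$ equivalent to the $\ell^1$-basis, i.e. there are $A,B>0$ with $A\sum_{i=1}^r|t_i|\ge\bigl\|\sum_{i=1}^r t_ix'_i\bigr\|\ge B\sum_{i=1}^r|t_i|$ for all $r$ and all $t_1,\ldots,t_r\in\mathbb K$, and that no sequence obtained from $(x'_n)$ by blocking converges to $0$ in the weak\*-topology. Then there are a sequence $(z'_m)$ obtained from $(x'_n)$ by blocking and a constant $c>0$ such that for every Banach limit $L$ the functionals $$w'_n(x):=L\bigl(\lambda_n\cdot(z'_1(x),z'_2(x),\ldots)\bigr)\qquad(x\in X,\ n=1,2,\ldots)$$ (pointwise product) belong to $X'$ and satisfy $\|w'_n\|\ge c$ for every $n$ and $\sum_n|w'_n(x)|^2<\infty$ for every $x\in X$. In particular there are $u'_1,u'_2,\ldots$ in $X'$ with $\|u'_n\|=1$ for all $n$ and $\sum_n|u'_n(x)|^2<\infty$ for every $x\in X$. -/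

import Mathlib

open Filter Topology
open scoped ENNReal

namespace JosefsonNissenzweig

/-- The sequence `x` is equivalent to the unit vector basis of `ℓ¹` (over `𝕜`): for some
`A, B > 0`, `B * ∑ ‖t i‖ ≤ ‖∑ t i • x i‖ ≤ A * ∑ ‖t i‖` for all finite families of scalars. -/
def IsEllOneBasis (𝕜 : Type*) [RCLike 𝕜] {E : Type*} [NormedAddCommGroup E] [NormedSpace 𝕜 E]
    (x : ℕ → E) : Prop :=
  ∃ A B : ℝ, 0 < A ∧ 0 < B ∧ ∀ (r : ℕ) (t : ℕ → 𝕜),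
    B * ∑ i ∈ Finset.range r, ‖t i‖ ≤ ‖∑ i ∈ Finset.range r, t i • x i‖ ∧
      ‖∑ i ∈ Finset.range r, t i • x i‖ ≤ A * ∑ i ∈ Finset.range r, ‖t i‖

/-- The sequence `y` is obtained from `x` by blocking: `y n = ∑ k ∈ S n, a k • x k` for finite
sets `S 0 < S 1 < ⋯` of natural numbers and scalars `a k` with `∑ k ∈ S n, ‖a k‖ = 1`
for every `n`. -/
def IsBlocking (𝕜 : Type*) [RCLike 𝕜] {E : Type*} [NormedAddCommGroup E] [NormedSpace 𝕜 E]
    (x y : ℕ → E) : Prop :=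
  ∃ (S : ℕ → Finset ℕ) (a : ℕ → 𝕜),
    (∀ m n, m < n → ∀ i ∈ S m, ∀ j ∈ S n, i < j) ∧
    (∀ n, ∑ k ∈ S n, ‖a k‖ = 1) ∧
    ∀ n, y n = ∑ k ∈ S n, a k • x k

/-- The functionals `y n` converge to `0` in the weak* topology. -/
def WeakStarNull {𝕜 : Type*} [RCLike 𝕜] {X : Type*} [NormedAddCommGroup X] [NormedSpace 𝕜 X]
    (y : ℕ → StrongDual 𝕜 X) : Prop :=
  ∀ x : X, Tendsto (fun n => y n x) atTop (𝓝 0)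

/-- The functionals `y n` form a weak*-`ℓ²` sequence. -/
def WeakStarEllTwo {𝕜 : Type*} [RCLike 𝕜] {X : Type*} [NormedAddCommGroup X] [NormedSpace 𝕜 X]
    (y : ℕ → StrongDual 𝕜 X) : Prop :=
  ∀ x : X, Summable (fun n => ‖y n x‖ ^ 2)

/-- A Banach limit: a functional `L` on `ℓ^∞` with `L (1, 1, …) = 1 = ‖L‖` that is invariant
under the left shift. -/
def IsBanachLimit {𝕜 : Type*} [RCLike 𝕜] (L : StrongDual 𝕜 (lp (fun _ : ℕ => 𝕜) ∞)) : Prop :=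
  L 1 = 1 ∧ ‖L‖ = 1 ∧
    ∀ u v : lp (fun _ : ℕ => 𝕜) ∞, (∀ m, v m = u (m + 1)) → L v = L u

/-- The `n`-th Rademacher-like sequence; indices start at `0`, so `n = 0, 1, 2, …` gives
`(1, -1, 1, -1, …)`, `(1, 1, -1, -1, 1, 1, …)`, `(1, 1, 1, 1, -1, -1, -1, -1, …)`, …. -/
def rademacherSeq (𝕜 : Type*) [RCLike 𝕜] (n m : ℕ) : 𝕜 := (-1) ^ (m / 2 ^ n)

/-- `w n` is the functional `x ↦ L (λ_n · (z 0 x, z 1 x, …))`, where `λ_n` is the `n`-th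
Rademacher-like sequence; the sequence `λ_n · (z 0 x, z 1 x, …)` is required to lie in `ℓ^∞`. -/
def IsRademacherAverage {𝕜 : Type*} [RCLike 𝕜] {X : Type*} [NormedAddCommGroup X]
    [NormedSpace 𝕜 X] (L : StrongDual 𝕜 (lp (fun _ : ℕ => 𝕜) ∞))
    (z w : ℕ → StrongDual 𝕜 X) : Prop :=
  ∀ (n : ℕ) (x : X), ∃ v : lp (fun _ : ℕ => 𝕜) ∞,
    (∀ m, v m = rademacherSeq 𝕜 n m * z m x) ∧ w n x = L v

end JosefsonNissenzweig

namespace JosefsonNissenzweig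

/-! Riesz's lemma gives a bounded sequence in the dual whose terms are at distance at least 1 from
each other. By Rosenthal's dichotomy (`exists_tendsto_or_isEllOneBasis`) it has a subsequence that
either converges pointwise on `X`, and then consecutive differences are weak*-null of norm at least
1, or is equivalent to the `ℓ¹`-basis. In the latter case blockings are bounded away from 0, so a
weak*-null blocking can be normalized. What remains is the case without weak*-null blockings.

There, `exists_stable_blocking` passes to a blocking whose `limsupNorm`, call it `ε`, cannot be
decreased by further blocking; `ε > 0` because no blocking is weak*-null. Averages with Rademacher
signs over blocks of length `2 ^ (n + 1)` are again a blocking, so at some point of the ball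
infinitely many of them nearly attain `ε`, although single terms hardly exceed `ε` there. All terms
of such a block must then nearly agree with a common phase times the Rademacher signs. Extraction
and a diagonal argument (`exists_rademacher_pattern`) produce a single subsequence showing every
Rademacher pattern eventually, so a Banach limit sees each pattern with size at least `ε / 2`.
Square-summability is Bessel's inequality: the Rademacher sequences are orthonormal for the positive
form `L (u * star v)`, because a shift by `2 ^ k` flips the `k`-th one and fixes the earlier ones.
-/

/-- Diagonal intersection of infinite sets of natural numbers. -/
theorem exists_diagonal_sequence (Q : ℕ → ℕ → Set ℕ → Prop)
    (hQ : ∀ k m s t, s ⊆ t → Q k m t → Q k m s) {M : Set ℕ} (hM : M.Infinite)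
    (h : ∀ k, ∀ m ∈ M, ∀ s ⊆ M, s.Infinite → ∃ t ⊆ s, t.Infinite ∧ Q k m t) :
    ∃ φ : ℕ → ℕ, StrictMono φ ∧ (∀ k, φ k ∈ M) ∧ ∀ k, Q k (φ k) (φ '' Set.Ioi k) := by
  have step : ∀ (k : ℕ) (s : {s : Set ℕ // s ⊆ M ∧ s.Infinite}),
      ∃ t : {s : Set ℕ // s ⊆ M ∧ s.Infinite},
        t.1 ⊆ s.1 ∩ Set.Ioi (sInf s.1) ∧ Q k (sInf s.1) t.1 := by
    rintro k ⟨s, hsM, hs⟩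
    have hinf : (s ∩ Set.Ioi (sInf s)).Infinite := by
      have := hs.sdiff (Set.finite_Iic (sInf s))
      refine this.mono fun a ha => ⟨ha.1, ?_⟩
      simpa using ha.2
    obtain ⟨t, hts, ht, hq⟩ := h k (sInf s) (hsM (Nat.sInf_mem hs.nonempty)) _
      (Set.inter_subset_left.trans hsM) hinf
    exact ⟨⟨t, hts.trans (Set.inter_subset_left.trans hsM), ht⟩, hts, hq⟩
  choose f hf hfQ using step
  let S : ℕ → {s : Set ℕ // s ⊆ M ∧ s.Infinite} :=
    fun k => Nat.rec ⟨M, subset_rfl, hM⟩ (fun k s => f k s) k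
  have hS : ∀ k, S (k + 1) = f k (S k) := fun _ => rfl
  have hmem : ∀ k, sInf (S k).1 ∈ (S k).1 := fun k => Nat.sInf_mem (S k).2.2.nonempty
  have hsub : ∀ k, (S (k + 1)).1 ⊆ (S k).1 ∩ Set.Ioi (sInf (S k).1) := fun k => by
    rw [hS]; exact hf k (S k)
  have hanti : Antitone fun k => (S k).1 :=
    antitone_nat_of_succ_le fun k => (hsub k).trans Set.inter_subset_left
  -- All minima chosen after step `k` lie in `S (k + 1)`, where `Q k` was arranged, and `Q` passes
  -- to subsets.
  refine ⟨fun k => sInf (S k).1, strictMono_nat_of_lt_succ fun k => (hsub k (hmem (k + 1))).2,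
    fun k => (S k).2.1 (hmem k), fun k => hQ _ _ _ _ ?_ (hfQ k (S k))⟩
  rintro _ ⟨j, hj, rfl⟩
  exact hanti (Nat.succ_le_of_lt hj) (hmem j)

/-! ### Combinatorics: from oscillation to Boolean independence -/

section Independence

variable {α : Type*}

/-- Along the indices in `M`, the point `x` lies infinitely often in sets of either family. -/
def Oscillates (A : Bool → ℕ → Set α) (x : α) (M : Set ℕ) : Prop :=
  ∀ b, {n ∈ M | x ∈ A b n}.Infinite

/-- Every infinite subset of `M` admits an oscillating point in `C`. -/
def HereditarilyOscillating (A : Bool → ℕ → Set α) (C : Set α) (M : Set ℕ) : Prop :=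
  ∀ s ⊆ M, s.Infinite → ∃ x ∈ C, Oscillates A x s

theorem Oscillates.mono {A : Bool → ℕ → Set α} {x : α} {s t : Set ℕ} (h : Oscillates A x s)
    (hst : s ⊆ t) : Oscillates A x t :=
  fun b => (h b).mono fun _ hn => ⟨hst hn.1, hn.2⟩

/-- If no `m` works, each `m` and each infinite `s` have a cell `C ∩ A b m` without points
oscillating along some infinite subset of `s`. Along a diagonal sequence the pigeonhole principle
makes the bad pair `(C, b)` constant on an infinite set. A point of that `C` oscillating along this
set enters `A b` at one of its indices and still oscillates along the tail, which is a
contradiction. -/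
theorem HereditarilyOscillating.exists_split {A : Bool → ℕ → Set α} {F : Set (Set α)}
    (hF : F.Finite) {M : Set ℕ} (hM : M.Infinite)
    (h : ∀ C ∈ F, HereditarilyOscillating A C M) :
    ∃ m ∈ M, ∃ s ⊆ M ∩ Set.Ioi m, s.Infinite ∧
      ∀ C ∈ F, ∀ b, HereditarilyOscillating A (C ∩ A b m) s := by
  suffices H : ∃ m ∈ M, ∃ s ⊆ M, s.Infinite ∧
      ∀ C ∈ F, ∀ b, HereditarilyOscillating A (C ∩ A b m) s by
    obtain ⟨m, hm, s, hsM, hs, H⟩ := H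
    refine ⟨m, hm, s ∩ Set.Ioi m, Set.inter_subset_inter_left _ hsM, ?_, fun C hC b t ht =>
      H C hC b t (ht.trans Set.inter_subset_left)⟩
    refine (hs.sdiff (Set.finite_Iic m)).mono fun a ha => ⟨ha.1, ?_⟩
    simpa using ha.2
  by_contra! hcon
  obtain ⟨φ, hφ, hφM, hQ⟩ := exists_diagonal_sequence
    (fun _ m t => ∃ C ∈ F, ∃ b, ∀ x ∈ C ∩ A b m, ¬ Oscillates A x t)
    (by
      rintro _ m s t hst ⟨C, hC, b, H⟩
      exact ⟨C, hC, b, fun x hx ho => H x hx (ho.mono hst)⟩) hM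
    (by
      intro _ m hm s hs hsi
      obtain ⟨C, hC, b, H⟩ := hcon m hm s hs hsi
      simp only [HereditarilyOscillating] at H
      push Not at H
      obtain ⟨t, hts, hti, H⟩ := H
      exact ⟨t, hts, hti, C, hC, b, H⟩)
  choose C hC b hCb using hQ
  have : Finite F := hF
  obtain ⟨⟨C₀, b₀⟩, hK⟩ := Finite.exists_infinite_fiber
    (fun k => ((⟨C k, hC k⟩, b k) : F × Bool))
  rw [Set.infinite_coe_iff] at hK
  set K := (fun k => ((⟨C k, hC k⟩, b k) : F × Bool)) ⁻¹' {(C₀, b₀)} with hKdef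
  obtain ⟨x, hx, hosc⟩ := h C₀ C₀.2 (φ '' K) (by rintro _ ⟨k, -, rfl⟩; exact hφM k)
    (hK.image hφ.injective.injOn)
  obtain ⟨_, ⟨k, hk, rfl⟩, hxk⟩ := (hosc b₀).nonempty
  have hk' : (⟨C k, hC k⟩, b k) = (C₀, b₀) := hk
  have h1 : C k = C₀ := congrArg (fun p => (p.1 : Set α)) hk'
  have h2 : b k = b₀ := congrArg Prod.snd hk'
  refine hCb k x ⟨h1 ▸ hx, h2 ▸ hxk⟩ fun c => ?_
  refine ((hosc c).sdiff ((Set.finite_Iic k).image φ)).mono ?_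
  rintro _ ⟨⟨⟨j, -, rfl⟩, hj⟩, hn⟩
  refine ⟨⟨j, ?_, rfl⟩, hj⟩
  by_contra hjk
  exact hn ⟨j, by simpa using hjk, rfl⟩

/-- Iterated splitting keeps a finite family of cells containing, for every sign pattern, the
intersection of the sets chosen so far. Each stays hereditarily oscillating and is therefore
nonempty. -/
theorem HereditarilyOscillating.exists_independent {A : Bool → ℕ → Set α} {M : Set ℕ}
    (hM : M.Infinite) (h : HereditarilyOscillating A Set.univ M) :
    ∃ φ : ℕ → ℕ, StrictMono φ ∧ ∀ (k : ℕ) (s : ℕ → Bool), ∃ x, ∀ j < k, x ∈ A (s j) (φ j) := by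
  let T := {p : Set (Set α) × Set ℕ // p.1.Finite ∧ p.2.Infinite ∧
    ∀ C ∈ p.1, HereditarilyOscillating A C p.2}
  have step : ∀ p : T, ∃ m ∈ p.1.2, ∃ q : T, q.1.2 ⊆ Set.Ioi m ∧
      ∀ C ∈ p.1.1, ∀ b, C ∩ A b m ∈ q.1.1 := by
    rintro ⟨⟨F, M⟩, hF, hM, hp⟩
    obtain ⟨m, hm, s, hsM, hs, H⟩ := exists_split hF hM hp
    refine ⟨m, hm, ⟨⟨Set.image2 (fun C b => C ∩ A b m) F Set.univ, s⟩,
      hF.image2 _ Set.finite_univ, hs, ?_⟩, hsM.trans Set.inter_subset_right,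
      fun C hC b => ⟨C, hC, b, trivial, rfl⟩⟩
    rintro _ ⟨C, hC, b, -, rfl⟩
    exact H C hC b
  choose m hm f hf hfA using step
  let S : ℕ → T := fun k => Nat.rec
    ⟨⟨{Set.univ}, M⟩, Set.finite_singleton _, hM, by rintro C rfl; exact h⟩ (fun _ p => f p) k
  have hS : ∀ k, S (k + 1) = f (S k) := fun _ => rfl
  refine ⟨fun k => m (S k), strictMono_nat_of_lt_succ fun k => ?_, fun k s => ?_⟩
  · exact hf (S k) (hm (S (k + 1)))
  · have key : ∀ k, {x | ∀ j < k, x ∈ A (s j) (m (S j))} ∈ (S k).1.1 := by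
      intro k
      induction k with
      | zero => simp [S]
      | succ k ih =>
        have := hfA (S k) _ ih (s k)
        rw [hS]
        convert this using 1
        ext x
        exact Nat.forall_lt_succ_right
    obtain ⟨x, hx, -⟩ := (S k).2.2.2 _ (key k) _ subset_rfl (S k).2.2.1
    exact ⟨x, hx⟩

end Independence

/-! ### Rosenthal's dichotomy -/

section Rosenthal

variable {𝕜 : Type*} [RCLike 𝕜] {X : Type*} [NormedAddCommGroup X] [NormedSpace 𝕜 X]

/-- Either the real or the imaginary parts carry at least half of the `ℓ¹`-norm; the signs are
chosen to match them. -/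
theorem exists_sign_half_sum_norm_le (F : Finset ℕ) (t : ℕ → 𝕜) :
    ∃ s : ℕ → Bool, (∑ i ∈ F, ‖t i‖) / 2 ≤ ‖∑ i ∈ F, t i * (if s i then 1 else -1)‖ := by
  have hsum : ∑ i ∈ F, ‖t i‖ ≤ ∑ i ∈ F, |RCLike.re (t i)| + ∑ i ∈ F, |RCLike.im (t i)| := by
    rw [← Finset.sum_add_distrib]
    refine Finset.sum_le_sum fun i _ => ?_
    have h := norm_add_le (RCLike.re (t i) : 𝕜) (RCLike.im (t i) * RCLike.I)
    rw [RCLike.re_add_im, RCLike.norm_ofReal, norm_mul, RCLike.norm_ofReal] at h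
    exact h.trans (by
      gcongr
      refine mul_le_of_le_one_right (abs_nonneg _) ?_
      rcases eq_or_ne (RCLike.I : 𝕜) 0 with hI | hI
      · simp [hI]
      · exact (RCLike.norm_I_of_ne_zero hI).le)
  rcases le_total (∑ i ∈ F, |RCLike.im (t i)|) (∑ i ∈ F, |RCLike.re (t i)|) with hle | hle
  · refine ⟨fun i => decide (0 ≤ RCLike.re (t i)), ?_⟩
    refine le_trans ?_ (RCLike.re_le_norm _)
    rw [map_sum]
    refine le_trans (by linarith) (Finset.sum_le_sum fun i _ => ?_ :
      ∑ i ∈ F, |RCLike.re (t i)| ≤ _)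
    by_cases h : 0 ≤ RCLike.re (t i)
    · simp [h, abs_of_nonneg]
    · simp [h, abs_of_neg (not_le.1 h)]
  · refine ⟨fun i => decide (0 ≤ RCLike.im (t i)), ?_⟩
    refine le_trans ?_ (RCLike.im_le_norm _)
    rw [map_sum]
    refine le_trans (by linarith) (Finset.sum_le_sum fun i _ => ?_ :
      ∑ i ∈ F, |RCLike.im (t i)| ≤ _)
    by_cases h : 0 ≤ RCLike.im (t i)
    · simp [h, abs_of_nonneg]
    · simp [h, abs_of_neg (not_le.1 h)]

/-- The points of the unit ball at which `y n` is within `η` of `p` (resp. `q`). -/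
def nearValues (y : ℕ → StrongDual 𝕜 X) (p q : 𝕜) (η : ℝ) (b : Bool) (n : ℕ) : Set X :=
  {x | ‖x‖ ≤ 1 ∧ ‖y n x - if b then p else q‖ ≤ η}

/-- Points `x`, `x'` realizing opposite patterns satisfy `y (φ i) (x - x') ≈ ± (p - q)` up to `2 *
η`, with prescribed signs. With `T = ∑ ‖t i‖` this gives `2 * ‖g‖ ≥ T * ‖p - q‖ / 2 - 2 * η * T ≥ T
* ‖p - q‖ / 4`, hence the lower constant `‖p - q‖ / 8`. -/
theorem isEllOneBasis_of_independent {y : ℕ → StrongDual 𝕜 X} {R : ℝ} (hR : ∀ n, ‖y n‖ ≤ R)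
    {p q : 𝕜} {η : ℝ} (hη : 0 < η) (hpq : 8 * η ≤ ‖p - q‖) {φ : ℕ → ℕ}
    (h : ∀ (k : ℕ) (s : ℕ → Bool), ∃ x, ∀ j < k, x ∈ nearValues y p q η (s j) (φ j)) :
    IsEllOneBasis 𝕜 (y ∘ φ) := by
  have hd : 0 < ‖p - q‖ := by linarith
  refine ⟨max R 1, ‖p - q‖ / 8, by positivity, by positivity, fun r t => ⟨?_, ?_⟩⟩
  · rcases Nat.eq_zero_or_pos r with rfl | hr
    · simp
    obtain ⟨s, hs⟩ := exists_sign_half_sum_norm_le (Finset.range r) t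
    obtain ⟨x, hx⟩ := h r s
    obtain ⟨x', hx'⟩ := h r (fun i => !s i)
    set g := ∑ i ∈ Finset.range r, t i • (y ∘ φ) i with hg
    have hxx : ‖x - x'‖ ≤ 2 := by
      have := norm_sub_le x x'
      linarith [(hx 0 hr).1, (hx' 0 hr).1]
    have hgx : g (x - x') = (∑ i ∈ Finset.range r, t i * (if s i then 1 else -1)) * (p - q) +
        ∑ i ∈ Finset.range r, t i *
          (y (φ i) (x - x') - (if s i then 1 else -1) * (p - q)) := by
      rw [hg, Finset.sum_mul, ← Finset.sum_add_distrib]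
      simp only [sum_apply, smul_apply, smul_eq_mul,
        Function.comp]
      exact Finset.sum_congr rfl fun i _ => by ring
    have herr : ‖∑ i ∈ Finset.range r, t i *
          (y (φ i) (x - x') - (if s i then 1 else -1) * (p - q))‖ ≤
        (∑ i ∈ Finset.range r, ‖t i‖) * (2 * η) := by
      rw [Finset.sum_mul]
      refine norm_sum_le_of_le _ fun i hi => ?_
      rw [norm_mul]
      refine mul_le_mul_of_nonneg_left ?_ (norm_nonneg _)
      have h1 := (hx i (Finset.mem_range.1 hi)).2
      have h2 := (hx' i (Finset.mem_range.1 hi)).2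
      have h3 := norm_sub_le (y (φ i) x - if s i then p else q)
        (y (φ i) x' - if !s i then p else q)
      refine le_trans (le_of_eq ?_) (h3.trans (by linarith))
      congr 1
      rw [map_sub]
      cases s i <;> simp <;> ring
    have h4 : ‖(∑ i ∈ Finset.range r, t i * (if s i then 1 else -1)) * (p - q)‖ ≤
        ‖g (x - x')‖ + (∑ i ∈ Finset.range r, ‖t i‖) * (2 * η) := by
      have := norm_sub_le (g (x - x')) (∑ i ∈ Finset.range r, t i *
          (y (φ i) (x - x') - (if s i then 1 else -1) * (p - q)))
      rw [hgx, add_sub_cancel_right, ← hgx] at this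
      linarith
    rw [norm_mul] at h4
    have h5 : ‖g (x - x')‖ ≤ ‖g‖ * 2 :=
      (g.le_opNorm _).trans (mul_le_mul_of_nonneg_left hxx (norm_nonneg _))
    have hT : 0 ≤ ∑ i ∈ Finset.range r, ‖t i‖ := Finset.sum_nonneg fun _ _ => norm_nonneg _
    nlinarith [mul_le_mul_of_nonneg_right hs hd.le, mul_le_mul_of_nonneg_left hpq hT]
  · rw [Finset.mul_sum]
    refine norm_sum_le_of_le _ fun i _ => ?_
    rw [norm_smul, mul_comm]
    exact mul_le_mul_of_nonneg_right ((hR _).trans (le_max_left _ _)) (norm_nonneg _)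

/-- Rosenthal's dichotomy for functionals, with pointwise convergence on `X`. -/
theorem exists_tendsto_or_isEllOneBasis {y : ℕ → StrongDual 𝕜 X} {R : ℝ}
    (hR : ∀ n, ‖y n‖ ≤ R) :
    ∃ φ : ℕ → ℕ, StrictMono φ ∧
      ((∀ x, ∃ l, Tendsto (fun n => y (φ n) x) atTop (𝓝 l)) ∨ IsEllOneBasis 𝕜 (y ∘ φ)) := by
  by_cases H : ∃ (p q : 𝕜) (η : ℝ) (M : Set ℕ), 0 < η ∧ 8 * η ≤ ‖p - q‖ ∧ M.Infinite ∧
      HereditarilyOscillating (nearValues y p q η) Set.univ M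
  · obtain ⟨p, q, η, M, hη, hpq, hM, h⟩ := H
    obtain ⟨φ, hφ, hind⟩ := h.exists_independent hM
    exact ⟨φ, hφ, Or.inr (isEllOneBasis_of_independent hR hη hpq hind)⟩
  push Not at H
  -- A single index `k` enumerates all triples of two points of a dense sequence and a tolerance `1
  -- / (l + 1)`, so that one diagonal sequence excludes oscillation for all of them.
  let P : ℕ → 𝕜 := fun k => TopologicalSpace.denseSeq 𝕜 k.unpair.1.unpair.1
  let Q : ℕ → 𝕜 := fun k => TopologicalSpace.denseSeq 𝕜 k.unpair.1.unpair.2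
  let E : ℕ → ℝ := fun k => 1 / ((k.unpair.2 : ℝ) + 1)
  obtain ⟨φ, hφ, -, hosc⟩ := exists_diagonal_sequence
    (fun k _ s => 8 * E k ≤ ‖P k - Q k‖ →
      ∀ x, ¬ Oscillates (nearValues y (P k) (Q k) (E k)) x s)
    (fun k _ s t hst h hk x ho => h hk x (ho.mono hst)) Set.infinite_univ
    (by
      intro k _ _ s _ hs
      by_cases hk : 8 * E k ≤ ‖P k - Q k‖
      · have := H (P k) (Q k) (E k) s (by positivity) hk hs
        simp only [HereditarilyOscillating] at this
        push Not at this
        obtain ⟨t, hts, ht, h⟩ := this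
        exact ⟨t, hts, ht, fun _ x => h x trivial⟩
      · exact ⟨s, subset_rfl, hs, fun h => absurd h hk⟩)
  refine ⟨φ, hφ, Or.inl ?_⟩
  have hball : ∀ x : X, ‖x‖ ≤ 1 → ∃ l, Tendsto (fun n => y (φ n) x) atTop (𝓝 l) := by
    intro x hx
    have hcpt : IsCompact (Metric.closedBall (0 : 𝕜) R) := isCompact_closedBall _ _
    have hmem : ∀ n, y (φ n) x ∈ Metric.closedBall (0 : 𝕜) R := fun n => by
      rw [mem_closedBall_zero_iff]
      calc ‖y (φ n) x‖ ≤ ‖y (φ n)‖ * ‖x‖ := (y (φ n)).le_opNorm x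
        _ ≤ R * 1 := mul_le_mul (hR _) hx (norm_nonneg _) ((norm_nonneg _).trans (hR 0))
        _ = R := mul_one R
    obtain ⟨p, hpR, hp⟩ := hcpt.exists_mapClusterPt_of_frequently (l := atTop)
      (f := fun n => y (φ n) x) (Eventually.of_forall hmem).frequently
    refine ⟨p, hcpt.tendsto_nhds_of_unique_mapClusterPt (Eventually.of_forall hmem)
      fun q _ hq => ?_⟩
    by_contra hne
    have hd : 0 < ‖p - q‖ := norm_pos_iff.2 (sub_ne_zero.2 (Ne.symm hne))
    -- Two distinct cluster points would force oscillation between dense points within `E k / 2` of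
    -- them. The factor 16 leaves room: `‖P k - Q k‖ ≥ ‖p - q‖ - E k > 15 * E k`.
    obtain ⟨l, hl⟩ := exists_nat_one_div_lt (show 0 < ‖p - q‖ / 16 by positivity)
    have hl0 : (0 : ℝ) < 1 / ((l : ℝ) + 1) := by positivity
    obtain ⟨i, hi⟩ := (TopologicalSpace.denseRange_denseSeq 𝕜).exists_dist_lt p
      (half_pos hl0)
    obtain ⟨j, hj⟩ := (TopologicalSpace.denseRange_denseSeq 𝕜).exists_dist_lt q
      (half_pos hl0)
    have hPk : P (Nat.pair (Nat.pair i j) l) = TopologicalSpace.denseSeq 𝕜 i := by simp [P]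
    have hQk : Q (Nat.pair (Nat.pair i j) l) = TopologicalSpace.denseSeq 𝕜 j := by simp [Q]
    have hEk : E (Nat.pair (Nat.pair i j) l) = 1 / ((l : ℝ) + 1) := by simp [E]
    set k := Nat.pair (Nat.pair i j) l
    rw [← hPk, ← hEk, dist_eq_norm] at hi
    rw [← hQk, ← hEk, dist_eq_norm] at hj
    rw [← hEk] at hl hl0
    have hdist : 8 * E k ≤ ‖P k - Q k‖ := by
      have h1 : ‖p - q‖ ≤ ‖p - P k‖ + ‖P k - Q k‖ + ‖q - Q k‖ := by
        calc ‖p - q‖ = ‖(p - P k) + (P k - Q k) - (q - Q k)‖ := by congr 1; ring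
          _ ≤ _ := (norm_sub_le _ _).trans (by gcongr; exact norm_add_le _ _)
      linarith
    have hfreq : ∀ (r d : 𝕜), MapClusterPt r atTop (fun n => y (φ n) x) → ‖r - d‖ < E k / 2 →
        ∀ b, (if b then P k else Q k) = d →
        {n ∈ φ '' Set.Ioi k | x ∈ nearValues y (P k) (Q k) (E k) b n}.Infinite := by
      intro r d hr hrd b hb
      have h1 : ∃ᶠ n in atTop, y (φ n) x ∈ Metric.ball r (E k / 2) :=
        hr.frequently (Metric.ball_mem_nhds _ (half_pos hl0))
      have h2 := h1.and_eventually (eventually_gt_atTop k)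
      rw [Nat.frequently_atTop_iff_infinite] at h2
      refine (h2.image hφ.injective.injOn).mono ?_
      rintro _ ⟨n, ⟨hn, hkn⟩, rfl⟩
      refine ⟨⟨n, hkn, rfl⟩, hx, ?_⟩
      rw [Metric.mem_ball, dist_eq_norm] at hn
      rw [hb]
      calc ‖y (φ n) x - d‖ = ‖(y (φ n) x - r) + (r - d)‖ := by congr 1; ring
        _ ≤ _ := (norm_add_le _ _).trans (by linarith)
    refine hosc k hdist x fun b => ?_
    cases b
    · exact hfreq q (Q k) hq hj false (by simp)
    · exact hfreq p (P k) hp hi true (by simp)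
  intro x
  rcases eq_or_ne x 0 with rfl | hx
  · exact hball 0 (by simp)
  have hx0 : (‖x‖ : 𝕜) ≠ 0 := by simpa using hx
  obtain ⟨l, hl⟩ := hball ((‖x‖ : 𝕜)⁻¹ • x) (by
    rw [norm_smul, norm_inv, RCLike.norm_ofReal, abs_norm, inv_mul_cancel₀ (norm_ne_zero_iff.2 hx)])
  refine ⟨(‖x‖ : 𝕜) * l, ?_⟩
  refine (hl.const_mul (‖x‖ : 𝕜)).congr fun n => ?_
  rw [map_smul, smul_eq_mul, mul_inv_cancel_left₀ hx0]

end Rosenthal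

/-! ### Calculus of blockings -/

section Blocking

variable {𝕜 : Type*} [RCLike 𝕜] {E : Type*} [NormedAddCommGroup E] [NormedSpace 𝕜 E]

variable (𝕜) in
/-- `v` is a combination of `x m, …, x (n - 1)` whose coefficients have `ℓ¹`-norm one. -/
def IsIntervalBlock (x : ℕ → E) (m n : ℕ) (v : E) : Prop :=
  ∃ a : ℕ → 𝕜, ∑ i ∈ Finset.Ico m n, ‖a i‖ = 1 ∧ v = ∑ i ∈ Finset.Ico m n, a i • x i

variable (𝕜) in
/-- Blocking with consecutive intervals as index sets. -/
def IsIntervalBlocking (x y : ℕ → E) : Prop :=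
  ∃ N : ℕ → ℕ, StrictMono N ∧ ∀ n, IsIntervalBlock 𝕜 x (N n) (N (n + 1)) (y n)

theorem StrictMono.index_unique {N : ℕ → ℕ} (hN : StrictMono N) {i m n : ℕ}
    (hm : i ∈ Finset.Ico (N m) (N (m + 1))) (hn : i ∈ Finset.Ico (N n) (N (n + 1))) : m = n := by
  rw [Finset.mem_Ico] at hm hn
  have h1 := hN.lt_iff_lt.1 (hm.1.trans_lt hn.2)
  have h2 := hN.lt_iff_lt.1 (hn.1.trans_lt hm.2)
  lia

theorem exists_glued_coefficients {N : ℕ → ℕ} (hN : StrictMono N) (b : ℕ → ℕ → 𝕜) :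
    ∃ a : ℕ → 𝕜, ∀ n, ∀ i ∈ Finset.Ico (N n) (N (n + 1)), a i = b n i := by
  classical
  refine ⟨fun i => if h : ∃ n, i ∈ Finset.Ico (N n) (N (n + 1)) then b h.choose i else 0,
    fun n i hi => ?_⟩
  have h : ∃ n, i ∈ Finset.Ico (N n) (N (n + 1)) := ⟨n, hi⟩
  simp only [dif_pos h]
  rw [StrictMono.index_unique hN h.choose_spec hi]

theorem sum_Ico_of_strictMono {M : Type*} [AddCommMonoid M] {N : ℕ → ℕ} (hN : StrictMono N)
    (f : ℕ → M) {m n : ℕ} (hmn : m ≤ n) :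
    ∑ i ∈ Finset.Ico (N m) (N n), f i =
      ∑ k ∈ Finset.Ico m n, ∑ i ∈ Finset.Ico (N k) (N (k + 1)), f i := by
  induction n, hmn using Nat.le_induction with
  | base => simp
  | succ n hmn ih =>
    rw [Finset.sum_Ico_succ_top hmn, ← ih, Finset.sum_Ico_consecutive _ (hN.monotone hmn)
      (hN.monotone n.le_succ)]

theorem IsIntervalBlocking.isBlocking {x y : ℕ → E} (h : IsIntervalBlocking 𝕜 x y) :
    IsBlocking 𝕜 x y := by
  obtain ⟨N, hN, h⟩ := h
  choose b hb hy using h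
  obtain ⟨a, ha⟩ := exists_glued_coefficients hN b
  refine ⟨fun n => Finset.Ico (N n) (N (n + 1)), a, fun m n hmn i hi j hj => ?_, fun n => ?_,
    fun n => ?_⟩
  · rw [Finset.mem_Ico] at hi hj
    exact hi.2.trans_le ((hN.monotone (Nat.succ_le_of_lt hmn)).trans hj.1)
  · rw [← hb n]
    exact Finset.sum_congr rfl fun i hi => by rw [ha n i hi]
  · rw [hy n]
    exact Finset.sum_congr rfl fun i hi => by rw [ha n i hi]

theorem IsIntervalBlock.le {x : ℕ → E} {m n : ℕ} {v : E} (h : IsIntervalBlock 𝕜 x m n v) :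
    m ≤ n := by
  by_contra hmn
  obtain ⟨a, ha, -⟩ := h
  rw [Finset.Ico_eq_empty_of_le (not_le.1 hmn).le] at ha
  simp at ha

theorem IsIntervalBlock.mono {x : ℕ → E} {m n m' n' : ℕ} {v : E}
    (h : IsIntervalBlock 𝕜 x m n v) (hm : m' ≤ m) (hn : n ≤ n') :
    IsIntervalBlock 𝕜 x m' n' v := by
  classical
  obtain ⟨a, ha, rfl⟩ := h
  have hsub : Finset.Ico m n ⊆ Finset.Ico m' n' := Finset.Ico_subset_Ico hm hn
  refine ⟨fun i => if i ∈ Finset.Ico m n then a i else 0, ?_, ?_⟩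
  · rw [← ha, ← Finset.sum_subset hsub]
    · exact Finset.sum_congr rfl fun i hi => by simp only [if_pos hi]
    · intro i _ hi
      simp only [if_neg hi, norm_zero]
  · rw [← Finset.sum_subset hsub]
    · exact Finset.sum_congr rfl fun i hi => by simp only [if_pos hi]
    · intro i _ hi
      simp only [if_neg hi, zero_smul]

/-- The coefficients multiply, and so do the `ℓ¹`-norms, because the inner index intervals are
disjoint. -/
theorem IsIntervalBlock.of_blocks {x y : ℕ → E} {N : ℕ → ℕ} (hN : StrictMono N)
    (hy : ∀ k, IsIntervalBlock 𝕜 x (N k) (N (k + 1)) (y k)) {m n : ℕ} {v : E}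
    (h : IsIntervalBlock 𝕜 y m n v) : IsIntervalBlock 𝕜 x (N m) (N n) v := by
  have hmn := h.le
  obtain ⟨c, hc, rfl⟩ := h
  choose b hb hyb using hy
  obtain ⟨a, ha⟩ := exists_glued_coefficients hN (fun k i => c k * b k i)
  refine ⟨a, ?_, ?_⟩
  · rw [sum_Ico_of_strictMono hN _ hmn, ← hc]
    refine Finset.sum_congr rfl fun k _ => ?_
    rw [← mul_one ‖c k‖, ← hb k, Finset.mul_sum]
    exact Finset.sum_congr rfl fun i hi => by rw [ha k i hi, norm_mul]
  · rw [sum_Ico_of_strictMono hN _ hmn]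
    refine Finset.sum_congr rfl fun k _ => ?_
    rw [hyb k, Finset.smul_sum]
    exact Finset.sum_congr rfl fun i hi => by rw [ha k i hi, mul_smul]

theorem IsIntervalBlocking.trans {x y z : ℕ → E} (hxy : IsIntervalBlocking 𝕜 x y)
    (hyz : IsIntervalBlocking 𝕜 y z) : IsIntervalBlocking 𝕜 x z := by
  obtain ⟨N, hN, hy⟩ := hxy
  obtain ⟨M, hM, hz⟩ := hyz
  exact ⟨N ∘ M, hN.comp hM, fun n => (hz n).of_blocks hN hy⟩

theorem isIntervalBlock_self (x : ℕ → E) (n : ℕ) : IsIntervalBlock 𝕜 x n (n + 1) (x n) :=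
  ⟨fun _ => 1, by simp, by simp⟩

theorem isIntervalBlocking_comp (x : ℕ → E) {φ : ℕ → ℕ} (hφ : StrictMono φ) :
    IsIntervalBlocking 𝕜 x (x ∘ φ) :=
  ⟨φ, hφ, fun n => (isIntervalBlock_self x (φ n)).mono le_rfl (hφ n.lt_succ_self)⟩

theorem IsIntervalBlocking.refl (x : ℕ → E) : IsIntervalBlocking 𝕜 x x :=
  isIntervalBlocking_comp x strictMono_id

theorem IsIntervalBlocking.shift {x y : ℕ → E} (h : IsIntervalBlocking 𝕜 x y) (m : ℕ) :
    IsIntervalBlocking 𝕜 (fun n => x (n + m)) (fun n => y (n + m)) := by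
  obtain ⟨N, hN, h⟩ := h
  have hle : ∀ n, m ≤ N (n + m) := fun n => (Nat.le_add_left m n).trans hN.le_apply
  refine ⟨fun n => N (n + m) - m, fun a b hab => ?_, fun n => ?_⟩
  · have := hN (Nat.add_lt_add_right hab m)
    have := hle a
    dsimp only
    lia
  · obtain ⟨a, ha, hy⟩ := h (n + m)
    have h1 : N (n + m) - m + m = N (n + m) := Nat.sub_add_cancel (hle n)
    have h2 : N (n + 1 + m) - m + m = N (n + m + 1) := by
      rw [Nat.sub_add_cancel (hle (n + 1)), add_right_comm]
    refine ⟨fun i => a (i + m), ?_, ?_⟩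
    · rw [Finset.sum_Ico_add' (fun i => ‖a i‖), h1, h2, ha]
    · rw [Finset.sum_Ico_add' (fun i => a i • x i), h1, h2]
      exact hy

/-- Diagonal sequences of iterated blockings are blockings. -/
theorem isIntervalBlocking_diagonal {y : ℕ → ℕ → E}
    (h : ∀ k, IsIntervalBlocking 𝕜 (y k) (y (k + 1))) (m : ℕ) :
    IsIntervalBlocking 𝕜 (y 0) (fun k => y k (k + m)) := by
  choose N hN hy using h
  -- `P k` is the composite of `N 0, …, N (k - 1)`; it gives the endpoints of the blocks of `y k` in
  -- terms of `y 0`.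
  let P : ℕ → ℕ → ℕ := fun k => Nat.rec id (fun k f => f ∘ N k) k
  have hP : ∀ k, StrictMono (P k) := fun k => by
    induction k with
    | zero => exact strictMono_id
    | succ k ih => exact ih.comp (hN k)
  have hblock : ∀ k n, IsIntervalBlock 𝕜 (y 0) (P k n) (P k (n + 1)) (y k n) := by
    intro k
    induction k with
    | zero => exact isIntervalBlock_self _
    | succ k ih => exact fun n => (hy k n).of_blocks (hP k) ih
  -- Diagonal blocks come from different levels; the next one starts no earlier than the current one
  -- ends.
  have hle : ∀ k, P k (k + m + 1) ≤ P (k + 1) (k + 1 + m) := fun k => by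
    rw [add_right_comm]
    exact (hP k).monotone ((hN k).le_apply)
  exact ⟨fun k => P k (k + m),
    strictMono_nat_of_lt_succ fun k => (hP k (k + m).lt_succ_self).trans_le (hle k),
    fun k => (hblock k (k + m)).mono le_rfl (hle k)⟩

end Blocking

/-! ### Blockings with minimal `limsupNorm` -/

section Stable

variable {𝕜 : Type*} [RCLike 𝕜] {X : Type*} [NormedAddCommGroup X] [NormedSpace 𝕜 X]

/-- The supremum over the unit ball of the upper limits of `‖y n x‖`. -/
noncomputable def limsupNorm (y : ℕ → StrongDual 𝕜 X) : ℝ :=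
  sInf {r | 0 ≤ r ∧ ∀ x, ‖x‖ ≤ 1 → ∀ᶠ n in atTop, ‖y n x‖ ≤ r}

theorem bddBelow_limsupNorm (y : ℕ → StrongDual 𝕜 X) :
    BddBelow {r : ℝ | 0 ≤ r ∧ ∀ x, ‖x‖ ≤ 1 → ∀ᶠ n in atTop, ‖y n x‖ ≤ r} :=
  ⟨0, fun _ hr => hr.1⟩

theorem nonempty_limsupNorm {y : ℕ → StrongDual 𝕜 X} {R : ℝ} (hR : ∀ n, ‖y n‖ ≤ R) :
    {r : ℝ | 0 ≤ r ∧ ∀ x, ‖x‖ ≤ 1 → ∀ᶠ n in atTop, ‖y n x‖ ≤ r}.Nonempty := by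
  have h0 : 0 ≤ R := (norm_nonneg _).trans (hR 0)
  exact ⟨R, h0, fun x hx => Eventually.of_forall fun n => (y n).le_of_opNorm_le_of_le (hR n) hx
    |>.trans_eq (mul_one R)⟩

theorem limsupNorm_nonneg (y : ℕ → StrongDual 𝕜 X) : 0 ≤ limsupNorm y :=
  Real.sInf_nonneg fun _ hr => hr.1

theorem eventually_le_of_limsupNorm_lt {y : ℕ → StrongDual 𝕜 X} {R : ℝ} (hR : ∀ n, ‖y n‖ ≤ R)
    {r : ℝ} (hr : limsupNorm y < r) {x : X} (hx : ‖x‖ ≤ 1) : ∀ᶠ n in atTop, ‖y n x‖ ≤ r := by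
  obtain ⟨s, hs, hsr⟩ := exists_lt_of_csInf_lt (nonempty_limsupNorm hR) hr
  filter_upwards [hs.2 x hx] with n hn using hn.trans hsr.le

theorem exists_frequently_of_lt_limsupNorm {y : ℕ → StrongDual 𝕜 X} {r : ℝ} (hr0 : 0 ≤ r)
    (hr : r < limsupNorm y) : ∃ x, ‖x‖ ≤ 1 ∧ ∃ᶠ n in atTop, r < ‖y n x‖ := by
  by_contra! H
  refine hr.not_ge (csInf_le (bddBelow_limsupNorm y) ⟨hr0, fun x hx => ?_⟩)
  simpa [not_frequently] using H x hx

theorem limsupNorm_shift (y : ℕ → StrongDual 𝕜 X) (m : ℕ) :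
    limsupNorm (fun n => y (n + m)) = limsupNorm y := by
  unfold limsupNorm
  congr 1
  ext r
  refine and_congr_right fun _ => forall₂_congr fun x _ => ?_
  rw [← Filter.eventually_map (m := fun n => n + m) (P := fun n => ‖y n x‖ ≤ r),
    map_add_atTop_eq_nat]

theorem IsIntervalBlock.norm_apply_le {x : ℕ → StrongDual 𝕜 X} {m n : ℕ} {v : StrongDual 𝕜 X}
    (h : IsIntervalBlock 𝕜 x m n v) {p : X} {r : ℝ} (hr : ∀ i, m ≤ i → ‖x i p‖ ≤ r) :
    ‖v p‖ ≤ r := by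
  obtain ⟨a, ha, rfl⟩ := h
  simp only [sum_apply, smul_apply, smul_eq_mul]
  calc ‖∑ i ∈ Finset.Ico m n, a i * x i p‖ ≤ ∑ i ∈ Finset.Ico m n, ‖a i‖ * r :=
        norm_sum_le_of_le _ fun i hi => by
          rw [norm_mul]
          exact mul_le_mul_of_nonneg_left (hr i (Finset.mem_Ico.1 hi).1) (norm_nonneg _)
    _ = r := by rw [← Finset.sum_mul, ha, one_mul]

theorem IsIntervalBlock.norm_le {x : ℕ → StrongDual 𝕜 X} {m n : ℕ} {v : StrongDual 𝕜 X}
    (h : IsIntervalBlock 𝕜 x m n v) {R : ℝ} (hR : ∀ i, ‖x i‖ ≤ R) : ‖v‖ ≤ R :=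
  ContinuousLinearMap.opNorm_le_bound _ ((norm_nonneg _).trans (hR 0)) fun p =>
    h.norm_apply_le fun i _ => (x i).le_of_opNorm_le (hR i) p

theorem IsIntervalBlocking.norm_le {x y : ℕ → StrongDual 𝕜 X} (h : IsIntervalBlocking 𝕜 x y)
    {R : ℝ} (hR : ∀ i, ‖x i‖ ≤ R) (n : ℕ) : ‖y n‖ ≤ R := by
  obtain ⟨N, -, h⟩ := h
  exact (h n).norm_le hR

/-- A bound valid for all late terms at a point survives combinations of late terms with `ℓ¹`-norm
one. -/
theorem IsIntervalBlocking.limsupNorm_le {x y : ℕ → StrongDual 𝕜 X}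
    (h : IsIntervalBlocking 𝕜 x y) {R : ℝ} (hR : ∀ i, ‖x i‖ ≤ R) :
    limsupNorm y ≤ limsupNorm x := by
  refine csInf_le_csInf (bddBelow_limsupNorm y) (nonempty_limsupNorm hR) ?_
  rintro r ⟨hr0, hr⟩
  refine ⟨hr0, fun p hp => ?_⟩
  obtain ⟨N, hN, h⟩ := h
  obtain ⟨k, hk⟩ := eventually_atTop.1 (hr p hp)
  filter_upwards [eventually_ge_atTop k] with n hn
  exact (h n).norm_apply_le fun i hi => hk i ((hn.trans hN.le_apply).trans hi)

/-- Every bounded sequence has a blocking for which `limsupNorm` cannot be decreased by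
further blocking. -/
theorem exists_stable_blocking {x : ℕ → StrongDual 𝕜 X} {R : ℝ} (hR : ∀ i, ‖x i‖ ≤ R) :
    ∃ y, IsIntervalBlocking 𝕜 x y ∧
      ∀ z, IsIntervalBlocking 𝕜 y z → limsupNorm z = limsupNorm y := by
  let V : (ℕ → StrongDual 𝕜 X) → Set ℝ := fun y => limsupNorm '' {z | IsIntervalBlocking 𝕜 y z}
  have hVb : ∀ y, BddBelow (V y) := fun y => ⟨0, by rintro _ ⟨z, -, rfl⟩; exact limsupNorm_nonneg z⟩
  -- Greedy choice: at stage `k` come within `1 / (k + 1)` of the infimum over all further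
  -- blockings.
  have step : ∀ (k : ℕ) (y : ℕ → StrongDual 𝕜 X), ∃ z, IsIntervalBlocking 𝕜 y z ∧
      limsupNorm z < sInf (V y) + 1 / ((k : ℝ) + 1) := by
    intro k y
    obtain ⟨_, ⟨z, hz, rfl⟩, hlt⟩ := exists_lt_of_csInf_lt (s := V y)
      ⟨_, y, IsIntervalBlocking.refl y, rfl⟩
      (lt_add_of_pos_right (sInf (V y)) (show (0 : ℝ) < 1 / ((k : ℝ) + 1) by positivity))
    exact ⟨z, hz, hlt⟩
  choose f hf hflt using step
  let y : ℕ → ℕ → StrongDual 𝕜 X := fun k => Nat.rec x (fun k z => f k z) k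
  have hy : ∀ k, IsIntervalBlocking 𝕜 (y k) (y (k + 1)) := fun k => hf k (y k)
  have hyR : ∀ k i, ‖y k i‖ ≤ R := fun k => by
    induction k with
    | zero => exact hR
    | succ k ih => exact (hy k).norm_le ih
  have htail : ∀ k, IsIntervalBlocking 𝕜 (y k) (fun n => y (n + k) (n + k)) := fun k => by
    have := isIntervalBlocking_diagonal (y := fun j => y (j + k))
      (fun j => by simpa only [add_right_comm] using hy (j + k)) k
    simpa using this
  have hd : IsIntervalBlocking 𝕜 x (fun n => y n n) := htail 0
  have hdR : ∀ i, ‖y i i‖ ≤ R := fun i => hyR i i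
  refine ⟨fun n => y n n, hd, fun z hz => (hz.limsupNorm_le hdR).antisymm ?_⟩
  refine le_of_forall_pos_le_add fun ε hε => ?_
  obtain ⟨k, hk⟩ := exists_nat_one_div_lt hε
  -- From index `k` on, a blocking `z` of the diagonal is a blocking of `y k`, so it competes in the
  -- infimum that `y (k + 1)` nearly attains; the diagonal itself is eventually a blocking of `y (k
  -- + 1)`.
  have h1 : limsupNorm (fun n => y n n) ≤ limsupNorm (y (k + 1)) := by
    rw [← limsupNorm_shift _ (k + 1)]
    exact (htail (k + 1)).limsupNorm_le (hyR (k + 1))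
  have h2 : limsupNorm (y (k + 1)) < sInf (V (y k)) + 1 / ((k : ℝ) + 1) := hflt k (y k)
  have h3 : sInf (V (y k)) ≤ limsupNorm z := by
    rw [← limsupNorm_shift z k]
    exact csInf_le (hVb _) ⟨_, (htail k).trans (hz.shift k), rfl⟩
  linarith

theorem weakStarNull_of_limsupNorm_eq_zero {y : ℕ → StrongDual 𝕜 X} {R : ℝ}
    (hR : ∀ i, ‖y i‖ ≤ R) (h : limsupNorm y = 0) : WeakStarNull y := by
  have hball : ∀ x : X, ‖x‖ ≤ 1 → Tendsto (fun n => y n x) atTop (𝓝 0) := by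
    intro x hx
    rw [Metric.tendsto_nhds]
    intro ε hε
    filter_upwards [eventually_le_of_limsupNorm_lt hR (h.trans_lt (half_pos hε)) hx] with n hn
    rw [dist_zero_right]
    linarith
  intro x
  rcases eq_or_ne x 0 with rfl | hx
  · exact hball 0 (by simp)
  have hx0 : (‖x‖ : 𝕜) ≠ 0 := by simpa using hx
  have hl := hball ((‖x‖ : 𝕜)⁻¹ • x) (by
    rw [norm_smul, norm_inv, RCLike.norm_ofReal, abs_norm, inv_mul_cancel₀ (norm_ne_zero_iff.2 hx)])
  rw [← mul_zero (‖x‖ : 𝕜)]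
  refine (hl.const_mul (‖x‖ : 𝕜)).congr fun n => ?_
  rw [map_smul, smul_eq_mul, mul_inv_cancel_left₀ hx0]

end Stable

/-! ### Rademacher patterns in stable sequences -/

section Rademacher

variable {𝕜 : Type*} [RCLike 𝕜]

/-- The sign depends only on the parity of `i / 2 ^ n`, that is, on the binary digit `n` of `i`. -/
theorem rademacherSeq_congr {n i j : ℕ} (h : i % 2 ^ (n + 1) = j % 2 ^ (n + 1)) :
    rademacherSeq 𝕜 n i = rademacherSeq 𝕜 n j := by
  unfold rademacherSeq
  rw [neg_one_pow_eq_pow_mod_two, neg_one_pow_eq_pow_mod_two (n := j / 2 ^ n),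
    ← Nat.mod_mul_right_div_self, ← Nat.mod_mul_right_div_self j, ← pow_succ, h]

theorem norm_rademacherSeq (n m : ℕ) : ‖rademacherSeq 𝕜 n m‖ = 1 := by
  simp [rademacherSeq]

theorem rademacherSeq_mul_self (n m : ℕ) :
    rademacherSeq 𝕜 n m * rademacherSeq 𝕜 n m = 1 := by
  rw [rademacherSeq, ← mul_pow]
  simp

theorem norm_sub_ofReal_sq (z : 𝕜) (r : ℝ) :
    ‖z - (r : 𝕜)‖ ^ 2 = ‖z‖ ^ 2 - 2 * r * RCLike.re z + r ^ 2 := by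
  rw [RCLike.norm_sq_eq_def, RCLike.norm_sq_eq_def]
  simp only [map_sub, RCLike.ofReal_re, RCLike.ofReal_im]
  ring

/-- If an average of `p` scalars is almost as large as the bound on the scalars, then they are
all close to each other. -/
theorem exists_phase_of_large_average {p : ℕ} {ε η : ℝ} (hε : 0 < ε)
    (hη : 200 * p * η = ε) {v : ℕ → 𝕜} (hv : ∀ j < p, ‖v j‖ ≤ ε + η)
    (hsum : p * (ε - η) < ‖∑ j ∈ Finset.range p, v j‖) :
    ∃ ω : 𝕜, ‖ω‖ = 1 ∧ ∀ j < p, ‖ω * v j - (ε : 𝕜)‖ ≤ ε / 4 := by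
  have hp : 0 < p := by
    rcases Nat.eq_zero_or_pos p with rfl | hp
    · simp at hη; linarith
    · exact hp
  have hp1 : (1 : ℝ) ≤ p := by exact_mod_cast hp
  have hη0 : 0 < η := by
    by_contra hcon
    have : 200 * (p : ℝ) * η ≤ 0 := mul_nonpos_of_nonneg_of_nonpos (by positivity) (not_lt.1 hcon)
    linarith
  have hηε : 200 * η ≤ ε := by nlinarith
  set S := ∑ j ∈ Finset.range p, v j with hS
  have hS0 : 0 < ‖S‖ := lt_of_le_of_lt (mul_nonneg (by positivity) (by linarith)) hsum
  have hS0' : (‖S‖ : 𝕜) ≠ 0 := by exact_mod_cast hS0.ne'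
  -- This phase turns the sum into the positive number `‖S‖`.
  refine ⟨starRingEnd 𝕜 S / ‖S‖, by simp [hS0.ne'], fun j hj => ?_⟩
  set ω := starRingEnd 𝕜 S / (‖S‖ : 𝕜) with hω
  have hω1 : ‖ω‖ = 1 := by simp [hω, hS0.ne']
  have hωS : ∑ i ∈ Finset.range p, RCLike.re (ω * v i) = ‖S‖ := by
    rw [← map_sum, ← Finset.mul_sum, ← hS, hω, div_mul_eq_mul_div, RCLike.conj_mul, sq,
      mul_div_assoc, div_self hS0', mul_one, RCLike.ofReal_re]
  have hle : ∀ i < p, RCLike.re (ω * v i) ≤ ε + η := fun i hi =>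
    (RCLike.re_le_norm _).trans (by rw [norm_mul, hω1, one_mul]; exact hv i hi)
  have hj' : ‖S‖ ≤ RCLike.re (ω * v j) + (p - 1) * (ε + η) := by
    rw [← hωS, ← Finset.add_sum_erase _ _ (Finset.mem_range.2 hj)]
    gcongr
    refine (Finset.sum_le_card_nsmul _ _ (ε + η) fun i hi =>
      hle i (Finset.mem_range.1 (Finset.mem_of_mem_erase hi))).trans_eq ?_
    rw [Finset.card_erase_of_mem (Finset.mem_range.2 hj), Finset.card_range, nsmul_eq_mul,
      Nat.cast_sub hp, Nat.cast_one]
  -- The other `p - 1` real parts are at most `ε + η`, so this one is at least `p * (ε - η) - (p -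
  -- 1) * (ε + η) ≥ ε - 2 * p * η`, and `2 * p * η = ε / 100`.
  have hre : ε - ε / 100 ≤ RCLike.re (ω * v j) := by nlinarith
  have hn : ‖ω * v j‖ ≤ ε + ε / 200 := by
    rw [norm_mul, hω1, one_mul]
    exact (hv j hj).trans (by linarith)
  have hn2 : ‖ω * v j‖ ^ 2 ≤ (ε + ε / 200) ^ 2 := pow_le_pow_left₀ (norm_nonneg _) hn 2
  refine pow_le_pow_iff_left₀ (norm_nonneg _) (by positivity) two_ne_zero |>.1 ?_
  rw [norm_sub_ofReal_sq]
  -- The square is at most `(1.005 ^ 2 - 2 * 0.99 + 1) * ε ^ 2`, about `0.03 * ε ^ 2`, below `ε ^ 2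
  -- / 16`.
  nlinarith

variable {X : Type*} [NormedAddCommGroup X] [NormedSpace 𝕜 X]

theorem isIntervalBlocking_rademacher_average (y : ℕ → StrongDual 𝕜 X) (n : ℕ) {p : ℕ}
    (hp : 0 < p) :
    IsIntervalBlocking 𝕜 y (fun m => ∑ i ∈ Finset.Ico (m * p) ((m + 1) * p),
      (rademacherSeq 𝕜 n i / p) • y i) := by
  refine ⟨fun m => m * p, fun a b hab => Nat.mul_lt_mul_of_pos_right hab hp, fun m =>
    ⟨fun i => rademacherSeq 𝕜 n i / p, ?_, rfl⟩⟩
  have hp' : (p : ℝ) ≠ 0 := by exact_mod_cast hp.ne'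
  simp [norm_rademacherSeq, add_mul, hp']

/-- Whole blocks of length `p` are selected by `τ` and positions within a block are kept; hence
residues modulo `p`, and with them the Rademacher signs, survive. -/
theorem strictMono_blockwise {p : ℕ} (hp : 0 < p) {τ : ℕ → ℕ} (hτ : StrictMono τ) :
    StrictMono fun i => τ (i / p) * p + i % p := by
  intro i j hij
  have hi := Nat.mod_lt i hp
  rcases (Nat.div_le_div_right (c := p) hij.le).eq_or_lt with h | h
  · have h1 := Nat.div_add_mod i p
    have h2 := Nat.div_add_mod j p
    rw [h] at h1
    simp only [h]
    lia
  · have h1 : (τ (i / p) + 1) * p ≤ τ (j / p) * p := Nat.mul_le_mul_right p (hτ h)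
    rw [add_mul, one_mul] at h1
    simp only
    lia

/-- The signed averages over blocks of length `2 ^ (n + 1)` form a blocking, so stability keeps
their `limsupNorm` at `ε`. At a suitable point infinitely many averages exceed `ε - η` while late
terms are at most `ε + η`, so the signed terms of such a block nearly share one phase. Compactness
of the unit sphere of scalars makes the phases converge, and their limit is absorbed into the point.
-/
theorem exists_rademacher_subsequence {y : ℕ → StrongDual 𝕜 X} {R : ℝ} (hR : ∀ i, ‖y i‖ ≤ R)
    (hstable : ∀ z, IsIntervalBlocking 𝕜 y z → limsupNorm z = limsupNorm y)
    (hpos : 0 < limsupNorm y) (n : ℕ) {φ : ℕ → ℕ} (hφ : StrictMono φ) :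
    ∃ σ : ℕ → ℕ, StrictMono σ ∧ (∀ i, σ i % 2 ^ (n + 1) = i % 2 ^ (n + 1)) ∧
      ∃ x, ‖x‖ ≤ 1 ∧ ∀ i, ‖rademacherSeq 𝕜 n i * y (φ (σ i)) x - (limsupNorm y : 𝕜)‖ ≤
        limsupNorm y / 2 := by
  set ε := limsupNorm y with hε
  set p := 2 ^ (n + 1) with hpdef
  have hp : 0 < p := by positivity
  have hp1 : (1 : ℝ) ≤ p := by exact_mod_cast hp
  have hp' : (p : ℝ) ≠ 0 := by positivity
  set η := ε / (200 * p) with hηdef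
  have hη : 200 * p * η = ε := by rw [hηdef]; field_simp
  have hη0 : 0 < η := by positivity
  have hηε : 200 * η ≤ ε := by nlinarith
  have hz := isIntervalBlocking_rademacher_average (y ∘ φ) n hp
  have hzε := hstable _ ((isIntervalBlocking_comp y hφ).trans hz)
  obtain ⟨x, hx, hfreq⟩ := exists_frequently_of_lt_limsupNorm
    (show 0 ≤ ε - η by linarith) ((by linarith : ε - η < ε).trans_eq hzε.symm)
  have hev : ∀ᶠ m in atTop, ∀ i, m * p ≤ i → ‖y (φ i) x‖ ≤ ε + η := by
    have h1 : ∀ᶠ i in atTop, ‖y i x‖ ≤ ε + η :=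
      eventually_le_of_limsupNorm_lt hR (by linarith : limsupNorm y < ε + η) hx
    obtain ⟨K, hK⟩ := eventually_atTop.1 h1
    filter_upwards [eventually_ge_atTop K] with m hm i hi
    exact hK _ ((hm.trans ((Nat.le_mul_of_pos_right m hp).trans hi)).trans hφ.le_apply)
  have hgood : ∃ᶠ m in atTop, ∃ ω : 𝕜, ‖ω‖ = 1 ∧ ∀ j < p,
      ‖y (φ (m * p + j)) x‖ ≤ ε + η ∧
      ‖ω * (rademacherSeq 𝕜 n (m * p + j) * y (φ (m * p + j)) x) - (ε : 𝕜)‖ ≤ ε / 4 := by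
    refine (hfreq.and_eventually hev).mono ?_
    rintro m ⟨h1, h2⟩
    have h3 := exists_phase_of_large_average hpos hη
      (v := fun j => rademacherSeq 𝕜 n (m * p + j) * y (φ (m * p + j)) x)
      (fun j _ => by
        rw [norm_mul, norm_rademacherSeq, one_mul]
        exact h2 _ (Nat.le_add_right _ _)) (by
        have h4 : (∑ i ∈ Finset.Ico (m * p) ((m + 1) * p),
            (rademacherSeq 𝕜 n i / p) • (y ∘ φ) i) x =
            (∑ j ∈ Finset.range p, rademacherSeq 𝕜 n (m * p + j) * y (φ (m * p + j)) x) / p := by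
          rw [Finset.sum_Ico_eq_sum_range, add_mul, one_mul, Nat.add_sub_cancel_left,
            Finset.sum_div, sum_apply]
          refine Finset.sum_congr rfl fun j _ => ?_
          simp only [smul_apply, smul_eq_mul, Function.comp]
          ring
        rw [h4, norm_div, RCLike.norm_natCast, lt_div_iff₀ (by positivity)] at h1
        linarith)
    obtain ⟨ω, hω, h3⟩ := h3
    exact ⟨ω, hω, fun j hj => ⟨h2 _ (Nat.le_add_right _ _), h3 j hj⟩⟩
  obtain ⟨τ₀, hτ₀, hgood⟩ := extraction_of_frequently_atTop hgood
  choose ω hω hgood using hgood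
  obtain ⟨ω₀, hω₀, ψ, hψ, hlim⟩ := (isCompact_sphere (0 : 𝕜) 1).tendsto_subseq
    (x := ω) (fun m => by simpa using hω m)
  -- Replacing the phase by its limit then costs at most `(ε + η) / 8`, which together with `ε / 4`
  -- stays below `ε / 2`.
  obtain ⟨K, hK⟩ := eventually_atTop.1
    (Metric.tendsto_nhds.1 hlim (1 / 8) (by norm_num))
  set τ : ℕ → ℕ := fun i => τ₀ (ψ (i + K)) with hτdef
  have hτ : StrictMono τ := hτ₀.comp (hψ.comp fun a b hab => Nat.add_lt_add_right hab K)
  refine ⟨fun i => τ (i / p) * p + i % p, strictMono_blockwise hp hτ, fun i => by simp,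
    ω₀ • x, ?_, fun i => ?_⟩
  · rw [norm_smul, mem_sphere_zero_iff_norm.1 hω₀, one_mul]
    exact hx
  · obtain ⟨hb, hc⟩ := hgood (ψ (i / p + K)) (i % p) (Nat.mod_lt i hp)
    have hd := hK (i / p + K) (Nat.le_add_left _ _)
    have hlam : rademacherSeq 𝕜 n (τ₀ (ψ (i / p + K)) * p + i % p) = rademacherSeq 𝕜 n i :=
      rademacherSeq_congr (by simp [← hpdef])
    rw [hlam] at hc
    rw [dist_comm, dist_eq_norm] at hd
    simp only [hτdef, map_smul, smul_eq_mul]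
    set v := y (φ (τ₀ (ψ (i / p + K)) * p + i % p)) x
    set l := rademacherSeq 𝕜 n i with hl
    have hv : ‖(ω₀ - ω (ψ (i / p + K))) * (l * v)‖ ≤ 1 / 8 * (ε + η) := by
      rw [norm_mul, norm_mul, hl, norm_rademacherSeq, one_mul]
      exact mul_le_mul hd.le hb (norm_nonneg _) (by norm_num)
    calc ‖l * (ω₀ * v) - (ε : 𝕜)‖
        = ‖(ω₀ - ω (ψ (i / p + K))) * (l * v) + (ω (ψ (i / p + K)) * (l * v) - (ε : 𝕜))‖ := by
          congr 1; ring
      _ ≤ 1 / 8 * (ε + η) + ε / 4 := (norm_add_le _ _).trans (add_le_add hv hc)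
      _ ≤ ε / 2 := by linarith

/-- A stable sequence has a subsequence which, tested at suitable points of the unit ball,
eventually resembles each of the Rademacher sequences. -/
theorem exists_rademacher_pattern {y : ℕ → StrongDual 𝕜 X} {R : ℝ} (hR : ∀ i, ‖y i‖ ≤ R)
    (hstable : ∀ z, IsIntervalBlocking 𝕜 y z → limsupNorm z = limsupNorm y)
    (hpos : 0 < limsupNorm y) :
    ∃ ψ : ℕ → ℕ, StrictMono ψ ∧ ∀ n, ∃ x, ‖x‖ ≤ 1 ∧ ∀ i, n ≤ i →
      ‖rademacherSeq 𝕜 n i * y (ψ i) x - (limsupNorm y : 𝕜)‖ ≤ limsupNorm y / 2 := by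
  choose σ hσ hmod x hx hσx using fun (n : ℕ) (φ : {φ : ℕ → ℕ // StrictMono φ}) =>
    exists_rademacher_subsequence hR hstable hpos n φ.2
  let Φ : ℕ → {φ : ℕ → ℕ // StrictMono φ} := fun n =>
    Nat.rec ⟨id, strictMono_id⟩ (fun n φ => ⟨φ.1 ∘ σ n φ, φ.2.comp (hσ n φ)⟩) n
  have hΦ : ∀ n i, (Φ (n + 1)).1 i = (Φ n).1 (σ n (Φ n) i) := fun _ _ => rfl
  refine ⟨fun i => (Φ (i + 1)).1 i, strictMono_nat_of_lt_succ fun i => ?_, fun n =>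
    ⟨x n (Φ n), hx n (Φ n), fun i hi => ?_⟩⟩
  · rw [hΦ (i + 1)]
    exact (Φ (i + 1)).2 (i.lt_succ_self.trans_le (hσ _ _).le_apply)
  -- Extraction `n` creates pattern `n`. Each later one preserves residues modulo a multiple of `2 ^
  -- (n + 1)`, so the signs still match. The diagonal takes entry `i` after extraction `i`, hence
  -- the condition `n ≤ i`.
  · have key : ∀ k, n ≤ k → ∀ i,
        ‖rademacherSeq 𝕜 n i * y ((Φ (k + 1)).1 i) (x n (Φ n)) - (limsupNorm y : 𝕜)‖ ≤
          limsupNorm y / 2 := by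
      intro k hk
      induction k, hk using Nat.le_induction with
      | base => exact fun i => hσx n (Φ n) i
      | succ k hk ih =>
        intro i
        have h1 := ih (σ (k + 1) (Φ (k + 1)) i)
        have hdvd : 2 ^ (n + 1) ∣ 2 ^ (k + 1 + 1) := pow_dvd_pow 2 (by lia)
        have h2 : rademacherSeq 𝕜 n (σ (k + 1) (Φ (k + 1)) i) = rademacherSeq 𝕜 n i := by
          refine rademacherSeq_congr ?_
          rw [← Nat.mod_mod_of_dvd _ hdvd, hmod, Nat.mod_mod_of_dvd _ hdvd]
        rw [h2] at h1
        exact h1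
    exact key i hi i

end Rademacher

/-! ### Banach limits: positivity, orthogonality, Bessel's inequality, existence -/

section BanachLimit

variable {𝕜 : Type*} [RCLike 𝕜]

theorem IsBanachLimit.norm_map_le {L : StrongDual 𝕜 (lp (fun _ : ℕ => 𝕜) ∞)}
    (hL : IsBanachLimit L) {u : lp (fun _ : ℕ => 𝕜) ∞} {C : ℝ} (hu : ∀ m, ‖u m‖ ≤ C) :
    ‖L u‖ ≤ C :=
  (L.le_of_opNorm_le_of_le hL.2.1.le
    (lp.norm_le_of_forall_le ((norm_nonneg _).trans (hu 0)) hu)).trans_eq (one_mul C)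

theorem IsBanachLimit.map_shift {L : StrongDual 𝕜 (lp (fun _ : ℕ => 𝕜) ∞)}
    (hL : IsBanachLimit L) {u v : lp (fun _ : ℕ => 𝕜) ∞} {k : ℕ} (h : ∀ m, v m = u (m + k)) :
    L v = L u := by
  induction k generalizing v with
  | zero =>
    congr 1
    ext m
    exact h m
  | succ k ih =>
    let w : lp (fun _ : ℕ => 𝕜) ∞ := ⟨fun m => u (m + k), memℓp_infty ⟨‖u‖, by
      rintro _ ⟨m, rfl⟩
      exact lp.norm_apply_le_norm ENNReal.top_ne_zero u (m + k)⟩⟩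
    rw [← ih (v := w) fun _ => rfl]
    refine hL.2.2 w v fun m => ?_
    rw [h m]
    change u (m + (k + 1)) = u (m + 1 + k)
    rw [add_assoc, add_comm k 1]

/-- Shift invariance discards the first `k` terms, and `L 1 = 1` allows the constant to be
subtracted inside `L`. -/
theorem IsBanachLimit.norm_map_sub_le {L : StrongDual 𝕜 (lp (fun _ : ℕ => 𝕜) ∞)}
    (hL : IsBanachLimit L) {u : lp (fun _ : ℕ => 𝕜) ∞} {a : 𝕜} {C : ℝ} {k : ℕ}
    (hu : ∀ m, k ≤ m → ‖u m - a‖ ≤ C) : ‖L u - a‖ ≤ C := by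
  let v : lp (fun _ : ℕ => 𝕜) ∞ := ⟨fun m => u (m + k), memℓp_infty ⟨‖u‖, by
    rintro _ ⟨m, rfl⟩
    exact lp.norm_apply_le_norm ENNReal.top_ne_zero u (m + k)⟩⟩
  have h1 : L v = L u := hL.map_shift fun _ => rfl
  have h2 : L v - a = L (v - a • 1) := by
    rw [map_sub, map_smul, hL.1, smul_eq_mul, mul_one]
  rw [← h1, h2]
  refine hL.norm_map_le fun m => ?_
  have : (v - a • (1 : lp (fun _ : ℕ => 𝕜) ∞)) m = u (m + k) - a := by
    change u (m + k) - a • (1 : 𝕜) = _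
    simp
  rw [this]
  exact hu _ (Nat.le_add_left k m)

/-- Positivity follows from `‖L‖ = L 1 = 1`: for `r > 0` the values of `u` lie in the disc about `r`
of radius `√(‖u‖ ^ 2 + r ^ 2)`, hence so does `L u`, and a large `r` excludes a negative real part.
-/
theorem IsBanachLimit.re_map_nonneg {L : StrongDual 𝕜 (lp (fun _ : ℕ => 𝕜) ∞)}
    (hL : IsBanachLimit L) {u : lp (fun _ : ℕ => 𝕜) ∞} (hu : ∀ m, 0 ≤ RCLike.re (u m)) :
    0 ≤ RCLike.re (L u) := by
  by_contra! hneg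
  set δ := -RCLike.re (L u) with hδ
  have hδ0 : 0 < δ := by linarith
  -- The disc estimate yields `2 * r * δ ≤ ‖u‖ ^ 2`, which fails once `r * δ = ‖u‖ ^ 2 + 1`.
  set r : ℝ := (‖u‖ ^ 2 + 1) / δ with hr
  have hr0 : 0 < r := by positivity
  have h1 : ‖L u - (r : 𝕜)‖ ≤ √(‖u‖ ^ 2 + r ^ 2) := by
    refine hL.norm_map_sub_le (k := 0) fun m _ => Real.le_sqrt_of_sq_le ?_
    rw [norm_sub_ofReal_sq]
    have h2 := pow_le_pow_left₀ (norm_nonneg _)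
      (lp.norm_apply_le_norm ENNReal.top_ne_zero u m) 2
    have h3 := mul_nonneg hr0.le (hu m)
    linarith
  have h4 := pow_le_pow_left₀ (norm_nonneg _) h1 2
  rw [Real.sq_sqrt (by positivity), norm_sub_ofReal_sq] at h4
  have h5 : r * δ = ‖u‖ ^ 2 + 1 := div_mul_cancel₀ _ hδ0.ne'
  nlinarith [sq_nonneg ‖L u‖, sq_nonneg ‖u‖]

/-- The `n`-th Rademacher-like sequence as an element of `ℓ^∞`. -/
def rademacherLp (𝕜 : Type*) [RCLike 𝕜] (n : ℕ) : lp (fun _ : ℕ => 𝕜) ∞ :=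
  ⟨rademacherSeq 𝕜 n, memℓp_infty ⟨1, by
    rintro _ ⟨m, rfl⟩
    exact (norm_rademacherSeq n m).le⟩⟩

theorem rademacherSeq_add_two_pow (n m : ℕ) :
    rademacherSeq 𝕜 n (m + 2 ^ n) = -rademacherSeq 𝕜 n m := by
  rw [rademacherSeq, Nat.add_div_right _ (by positivity), pow_succ, mul_neg_one, rademacherSeq]

theorem rademacherSeq_add_two_pow_of_lt {n k : ℕ} (h : n < k) (m : ℕ) :
    rademacherSeq 𝕜 n (m + 2 ^ k) = rademacherSeq 𝕜 n m := by
  refine rademacherSeq_congr ?_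
  obtain ⟨c, hc⟩ := pow_dvd_pow 2 (Nat.succ_le_of_lt h)
  rw [hc, Nat.add_mul_mod_self_left]

/-- A shift by `2 ^ k` flips the `k`-th sequence and fixes the `n`-th, so the value equals its own
negative. -/
theorem IsBanachLimit.map_rademacherLp_mul_of_lt {L : StrongDual 𝕜 (lp (fun _ : ℕ => 𝕜) ∞)}
    (hL : IsBanachLimit L) {n k : ℕ} (h : n < k) :
    L (rademacherLp 𝕜 n * rademacherLp 𝕜 k) = 0 := by
  have h1 : L (-(rademacherLp 𝕜 n * rademacherLp 𝕜 k)) =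
      L (rademacherLp 𝕜 n * rademacherLp 𝕜 k) := by
    refine hL.map_shift (k := 2 ^ k) fun m => ?_
    change -(rademacherSeq 𝕜 n m * rademacherSeq 𝕜 k m) =
      rademacherSeq 𝕜 n (m + 2 ^ k) * rademacherSeq 𝕜 k (m + 2 ^ k)
    rw [rademacherSeq_add_two_pow, rademacherSeq_add_two_pow_of_lt h, mul_neg]
  rw [map_neg] at h1
  exact neg_eq_self.1 h1

theorem IsBanachLimit.map_rademacherLp_mul {L : StrongDual 𝕜 (lp (fun _ : ℕ => 𝕜) ∞)}
    (hL : IsBanachLimit L) (n k : ℕ) :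
    L (rademacherLp 𝕜 n * rademacherLp 𝕜 k) = if n = k then 1 else 0 := by
  rcases lt_trichotomy n k with h | rfl | h
  · rw [if_neg h.ne, hL.map_rademacherLp_mul_of_lt h]
  · rw [if_pos rfl, ← hL.1]
    congr 1
    ext m
    exact rademacherSeq_mul_self n m
  · rw [if_neg h.ne', mul_comm, hL.map_rademacherLp_mul_of_lt h]

theorem conj_rademacherSeq (n m : ℕ) :
    starRingEnd 𝕜 (rademacherSeq 𝕜 n m) = rademacherSeq 𝕜 n m := by
  simp [rademacherSeq]

/-- Bessel's inequality for the Rademacher coefficients with respect to a Banach limit. -/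
theorem IsBanachLimit.sum_sq_norm_map_le {L : StrongDual 𝕜 (lp (fun _ : ℕ => 𝕜) ∞)}
    (hL : IsBanachLimit L) (v : lp (fun _ : ℕ => 𝕜) ∞) (F : Finset ℕ) :
    ∑ n ∈ F, ‖L (rademacherLp 𝕜 n * v)‖ ^ 2 ≤ ‖v‖ ^ 2 := by
  set c : ℕ → 𝕜 := fun n => L (rademacherLp 𝕜 n * v) with hc
  set g : lp (fun _ : ℕ => 𝕜) ∞ := ∑ n ∈ F, starRingEnd 𝕜 (c n) • rademacherLp 𝕜 n with hg
  set h : lp (fun _ : ℕ => 𝕜) ∞ := ∑ n ∈ F, c n • rademacherLp 𝕜 n with hh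
  have hS : ∑ n ∈ F, starRingEnd 𝕜 (c n) * c n = ((∑ n ∈ F, ‖c n‖ ^ 2 : ℝ) : 𝕜) := by
    rw [RCLike.ofReal_sum]
    exact Finset.sum_congr rfl fun n _ => by rw [RCLike.conj_mul, RCLike.ofReal_pow]
  have hgv : L (g * v) = ((∑ n ∈ F, ‖c n‖ ^ 2 : ℝ) : 𝕜) := by
    rw [← hS, hg, Finset.sum_mul, map_sum]
    exact Finset.sum_congr rfl fun n _ => by rw [smul_mul_assoc, map_smul, smul_eq_mul]
  have hgh : L (g * h) = ((∑ n ∈ F, ‖c n‖ ^ 2 : ℝ) : 𝕜) := by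
    rw [← hS, hg, hh, Finset.sum_mul_sum, map_sum]
    refine Finset.sum_congr rfl fun n hn => ?_
    rw [map_sum, Finset.sum_eq_single_of_mem n hn]
    · rw [smul_mul_smul_comm, map_smul, hL.map_rademacherLp_mul, if_pos rfl, smul_eq_mul, mul_one]
    · intro k _ hk
      rw [smul_mul_smul_comm, map_smul, hL.map_rademacherLp_mul, if_neg hk.symm, smul_zero]
  have hgm : ∀ m, g m = ∑ n ∈ F, starRingEnd 𝕜 (c n) * rademacherSeq 𝕜 n m := fun m => by
    rw [hg, lp.coeFn_sum, Finset.sum_apply]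
    rfl
  have hhm : ∀ m, h m = starRingEnd 𝕜 (g m) := fun m => by
    rw [hgm, hh, lp.coeFn_sum, Finset.sum_apply, map_sum]
    refine Finset.sum_congr rfl fun n _ => ?_
    rw [map_mul, RCLike.conj_conj, conj_rademacherSeq]
    rfl
  -- Here `h` is the projection of `v` and `g` its pointwise conjugate, so the real part of the
  -- argument is `‖v m - h m‖ ^ 2`. Since only real parts matter, `g * v` taken twice replaces `g *
  -- v` plus its conjugate.
  have hpos : 0 ≤ RCLike.re (L (v * star v + g * h - (g * v + g * v))) := by
    refine hL.re_map_nonneg fun m => ?_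
    change 0 ≤ RCLike.re (v m * starRingEnd 𝕜 (v m) + g m * h m - (g m * v m + g m * v m))
    rw [hhm, RCLike.mul_conj, RCLike.mul_conj]
    simp only [map_add, map_sub, ← RCLike.ofReal_pow, RCLike.ofReal_re]
    have h1 : RCLike.re (g m * v m) ≤ ‖g m‖ * ‖v m‖ :=
      (RCLike.re_le_norm _).trans_eq (norm_mul _ _)
    nlinarith [sq_nonneg (‖g m‖ - ‖v m‖)]
  have hv : RCLike.re (L (v * star v)) ≤ ‖v‖ ^ 2 := by
    refine (RCLike.re_le_norm _).trans (hL.norm_map_le fun m => ?_)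
    change ‖v m * starRingEnd 𝕜 (v m)‖ ≤ _
    rw [norm_mul, RCLike.norm_conj, ← sq]
    exact pow_le_pow_left₀ (norm_nonneg _) (lp.norm_apply_le_norm ENNReal.top_ne_zero v m) 2
  rw [map_sub, map_add, map_add, hgv, hgh] at hpos
  simp only [map_add, map_sub, RCLike.ofReal_re] at hpos
  linarith

/-- The arithmetic means of the first `N + 1` terms. -/
noncomputable def cesaro (u : lp (fun _ : ℕ => 𝕜) ∞) (N : ℕ) : 𝕜 :=
  (∑ i ∈ Finset.range (N + 1), u i) / ((N : 𝕜) + 1)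

theorem norm_natCast_add_one (N : ℕ) : ‖(N : 𝕜) + 1‖ = (N : ℝ) + 1 := by
  rw [← Nat.cast_succ, RCLike.norm_natCast, Nat.cast_succ]

theorem norm_cesaro_le (u : lp (fun _ : ℕ => 𝕜) ∞) (N : ℕ) : ‖cesaro u N‖ ≤ ‖u‖ := by
  rw [cesaro, norm_div, norm_natCast_add_one, div_le_iff₀ (by positivity)]
  refine (norm_sum_le_of_le _ fun i _ =>
    lp.norm_apply_le_norm ENNReal.top_ne_zero u i).trans_eq ?_
  simp [mul_comm]

/-- The limit of the arithmetic means along a nonprincipal ultrafilter; the means of a sequence and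
of its shift differ by `(u (N + 1) - u 0) / (N + 1)`, which tends to 0. -/
theorem exists_isBanachLimit (𝕜 : Type*) [RCLike 𝕜] :
    ∃ L : StrongDual 𝕜 (lp (fun _ : ℕ => 𝕜) ∞), IsBanachLimit L := by
  have hlim : ∀ u : lp (fun _ : ℕ => 𝕜) ∞, ∃ l,
      Tendsto (cesaro u) (hyperfilter ℕ : Filter ℕ) (𝓝 l) := fun u => by
    obtain ⟨l, -, hl⟩ := (isCompact_closedBall (0 : 𝕜) ‖u‖).ultrafilter_le_nhds
      ((hyperfilter ℕ).map (cesaro u)) (by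
        rw [le_principal_iff]
        exact Ultrafilter.mem_map.2 <| Filter.univ_mem' fun N => mem_closedBall_zero_iff.2 (norm_cesaro_le u N))
    exact ⟨l, hl⟩
  choose f hf using hlim
  let L : StrongDual 𝕜 (lp (fun _ : ℕ => 𝕜) ∞) := LinearMap.mkContinuous
    { toFun := f
      map_add' := fun u v => tendsto_nhds_unique (hf (u + v)) <| by
        refine ((hf u).add (hf v)).congr fun N => ?_
        rw [cesaro, cesaro, cesaro, ← add_div, ← Finset.sum_add_distrib]
        rfl
      map_smul' := fun a u => tendsto_nhds_unique (hf (a • u)) <| by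
        refine ((hf u).const_mul a).congr fun N => ?_
        rw [cesaro, cesaro, ← mul_div_assoc, Finset.mul_sum]
        rfl } 1 fun u => by
      rw [one_mul]
      exact le_of_tendsto (hf u).norm (Eventually.of_forall (norm_cesaro_le u))
  have hL1 : L 1 = 1 := by
    refine tendsto_nhds_unique (hf 1) (tendsto_const_nhds.congr fun N => ?_)
    have hN : (N : 𝕜) + 1 ≠ 0 := Nat.cast_add_one_ne_zero N
    rw [cesaro]
    simp only [lp.infty_coeFn_one, Pi.one_apply, Finset.sum_const, Finset.card_range,
      nsmul_eq_mul, mul_one, Nat.cast_succ]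
    exact (div_self hN).symm
  refine ⟨L, hL1, le_antisymm (LinearMap.mkContinuous_norm_le _ zero_le_one _) ?_,
    fun u v h => ?_⟩
  · have := L.le_opNorm 1
    rwa [hL1, norm_one, norm_one, mul_one] at this
  · have hdiff : Tendsto (fun N => cesaro v N - cesaro u N) atTop (𝓝 0) := by
      refine squeeze_zero_norm (a := fun N : ℕ => 2 * ‖u‖ * (1 / ((N : ℝ) + 1))) (fun N => ?_) ?_
      · have h1 : cesaro v N - cesaro u N = (u (N + 1) - u 0) / ((N : 𝕜) + 1) := by
          rw [cesaro, cesaro, ← sub_div]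
          congr 1
          simp only [h]
          rw [Finset.sum_range_succ, Finset.sum_range_succ' (fun i => u i)]
          ring
        rw [h1, norm_div, norm_natCast_add_one, div_eq_mul_one_div]
        gcongr
        have h2 := norm_sub_le (u (N + 1)) (u 0)
        have h3 := lp.norm_apply_le_norm ENNReal.top_ne_zero u (N + 1)
        have h4 := lp.norm_apply_le_norm ENNReal.top_ne_zero u 0
        linarith
      · simpa using tendsto_one_div_add_atTop_nhds_zero_nat.const_mul (2 * ‖u‖)
    have h5 : Tendsto (fun N => cesaro v N - cesaro u N) (hyperfilter ℕ : Filter ℕ) (𝓝 0) :=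
      hdiff.mono_left Nat.hyperfilter_le_atTop
    exact sub_eq_zero.1 (tendsto_nhds_unique ((hf v).sub (hf u)) h5)

end BanachLimit

/-! ### Rademacher averages and the Josefson–Nissenzweig theorem -/

section Main

variable {𝕜 : Type*} [RCLike 𝕜] {X : Type*} [NormedAddCommGroup X] [NormedSpace 𝕜 X]

/-- The operator `x ↦ (y 0 x, y 1 x, …)` into `ℓ^∞` of a bounded sequence of functionals. -/
noncomputable def evalSequence (y : ℕ → StrongDual 𝕜 X) {R : ℝ} (hR : ∀ i, ‖y i‖ ≤ R) :
    X →L[𝕜] lp (fun _ : ℕ => 𝕜) ∞ :=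
  LinearMap.mkContinuous
    { toFun := fun x => ⟨fun m => y m x, memℓp_infty ⟨R * ‖x‖, by
        rintro _ ⟨m, rfl⟩
        exact (y m).le_of_opNorm_le (hR m) x⟩⟩
      map_add' := fun x x' => by
        ext m
        exact map_add (y m) x x'
      map_smul' := fun a x => by
        ext m
        exact map_smul (y m) a x } R fun x =>
    lp.norm_le_of_forall_le (mul_nonneg ((norm_nonneg _).trans (hR 0)) (norm_nonneg x))
      fun m => (y m).le_of_opNorm_le (hR m) x

theorem exists_isRademacherAverage {z : ℕ → StrongDual 𝕜 X} {R : ℝ} (hR : ∀ i, ‖z i‖ ≤ R)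
    {L : StrongDual 𝕜 (lp (fun _ : ℕ => 𝕜) ∞)} (hL : IsBanachLimit L) :
    ∃ w, IsRademacherAverage L z w ∧ WeakStarEllTwo w := by
  refine ⟨fun n => L ∘L ContinuousLinearMap.mul 𝕜 _ (rademacherLp 𝕜 n) ∘L evalSequence z hR,
    fun n x => ⟨rademacherLp 𝕜 n * evalSequence z hR x, fun m => rfl, rfl⟩, fun x => ?_⟩
  exact summable_of_sum_le (fun _ => by positivity) (hL.sum_sq_norm_map_le (evalSequence z hR x))

theorem IsRademacherAverage.le_norm {z w : ℕ → StrongDual 𝕜 X}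
    {L : StrongDual 𝕜 (lp (fun _ : ℕ => 𝕜) ∞)} (hL : IsBanachLimit L)
    (hw : IsRademacherAverage L z w) {n k : ℕ} {ε : ℝ} (hε : 0 ≤ ε) {x : X} (hx : ‖x‖ ≤ 1)
    (h : ∀ i, k ≤ i → ‖rademacherSeq 𝕜 n i * z i x - (ε : 𝕜)‖ ≤ ε / 2) : ε / 2 ≤ ‖w n‖ := by
  obtain ⟨v, hv, hwv⟩ := hw n x
  have h1 : ‖L v - (ε : 𝕜)‖ ≤ ε / 2 :=
    hL.norm_map_sub_le (k := k) fun m hm => by rw [hv]; exact h m hm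
  have h2 : ‖(ε : 𝕜)‖ ≤ ‖L v‖ + ‖L v - (ε : 𝕜)‖ := by
    have := norm_sub_le (L v) (L v - (ε : 𝕜))
    rwa [sub_sub_cancel] at this
  rw [RCLike.norm_ofReal, abs_of_nonneg hε] at h2
  have h3 : ‖w n x‖ ≤ ‖w n‖ * 1 := (w n).le_opNorm_of_le hx
  rw [hwv, mul_one] at h3
  linarith

/-- A bounded sequence without weak*-null blockings has a blocking whose Rademacher averages are
bounded away from zero and weak*-square-summable. -/
theorem exists_blocking_rademacherAverage {y : ℕ → StrongDual 𝕜 X} {R : ℝ}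
    (hR : ∀ i, ‖y i‖ ≤ R) (hnull : ∀ z, IsBlocking 𝕜 y z → ¬ WeakStarNull z) :
    ∃ (z : ℕ → StrongDual 𝕜 X) (c : ℝ), IsBlocking 𝕜 y z ∧ 0 < c ∧
      ∀ L : StrongDual 𝕜 (lp (fun _ : ℕ => 𝕜) ∞), IsBanachLimit L →
        ∃ w, IsRademacherAverage L z w ∧ (∀ n, c ≤ ‖w n‖) ∧ WeakStarEllTwo w := by
  obtain ⟨s, hs, hstable⟩ := exists_stable_blocking hR
  have hsR := hs.norm_le hR
  have hpos : 0 < limsupNorm s := (limsupNorm_nonneg s).lt_of_ne' fun h =>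
    hnull s hs.isBlocking (weakStarNull_of_limsupNorm_eq_zero hsR h)
  obtain ⟨ψ, hψ, hpat⟩ := exists_rademacher_pattern hsR hstable hpos
  refine ⟨s ∘ ψ, limsupNorm s / 2, (hs.trans (isIntervalBlocking_comp s hψ)).isBlocking,
    half_pos hpos, fun L hL => ?_⟩
  obtain ⟨w, hw, hw2⟩ := exists_isRademacherAverage (z := s ∘ ψ) (fun i => hsR (ψ i)) hL
  refine ⟨w, hw, fun n => ?_, hw2⟩
  obtain ⟨x, hx, h⟩ := hpat n
  exact hw.le_norm hL hpos.le hx h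

theorem IsEllOneBasis.exists_norm_le {x : ℕ → StrongDual 𝕜 X} (h : IsEllOneBasis 𝕜 x) :
    ∃ R : ℝ, ∀ i, ‖x i‖ ≤ R := by
  classical
  obtain ⟨A, B, -, -, h⟩ := h
  refine ⟨A, fun i => ?_⟩
  have := (h (i + 1) (Pi.single i 1)).2
  rwa [Finset.sum_eq_single_of_mem i (Finset.self_mem_range_succ i)
      (fun j _ hj => by simp [hj]),
    Finset.sum_eq_single_of_mem i (Finset.self_mem_range_succ i)
      (fun j _ hj => by simp [hj]), Pi.single_eq_same, one_smul, norm_one, mul_one] at this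

theorem IsEllOneBasis.exists_le_norm_of_isBlocking {x : ℕ → StrongDual 𝕜 X}
    (h : IsEllOneBasis 𝕜 x) :
    ∃ c : ℝ, 0 < c ∧ ∀ y, IsBlocking 𝕜 x y → ∀ n, c ≤ ‖y n‖ := by
  classical
  obtain ⟨A, B, -, hB, h⟩ := h
  refine ⟨B, hB, ?_⟩
  rintro y ⟨S, a, -, ha, hy⟩ n
  have hsub : S n ⊆ Finset.range ((S n).sup id + 1) := fun i hi =>
    Finset.mem_range.2 (Nat.lt_succ_of_le (Finset.le_sup (f := id) hi))
  have := (h ((S n).sup id + 1) (fun i => if i ∈ S n then a i else 0)).1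
  rw [← Finset.sum_subset hsub (fun i _ hi => by simp [hi]),
    ← Finset.sum_subset hsub (fun i _ hi => by simp [hi]),
    Finset.sum_congr rfl (g := fun i => ‖a i‖) (fun i hi => by simp [hi]),
    Finset.sum_congr rfl (g := fun i => a i • x i) (fun i hi => by simp [hi]),
    ha n, mul_one, ← hy n] at this
  exact this

theorem exists_normalized {y : ℕ → StrongDual 𝕜 X} {c : ℝ} (hc : 0 < c)
    (hy : ∀ n, c ≤ ‖y n‖) :
    ∃ u : ℕ → StrongDual 𝕜 X, (∀ n, ‖u n‖ = 1) ∧ ∀ n x, ‖u n x‖ ≤ c⁻¹ * ‖y n x‖ := by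
  have hpos : ∀ n, 0 < ‖y n‖ := fun n => hc.trans_le (hy n)
  refine ⟨fun n => ((‖y n‖ : 𝕜)⁻¹) • y n, fun n => ?_, fun n x => ?_⟩
  · rw [norm_smul, norm_inv, RCLike.norm_ofReal, abs_norm, inv_mul_cancel₀ (hpos n).ne']
  · rw [smul_apply, norm_smul, norm_inv, RCLike.norm_ofReal, abs_norm]
    gcongr
    exact hy n

theorem WeakStarNull.exists_normalized {y : ℕ → StrongDual 𝕜 X} (h : WeakStarNull y) {c : ℝ}
    (hc : 0 < c) (hy : ∀ n, c ≤ ‖y n‖) :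
    ∃ u : ℕ → StrongDual 𝕜 X, (∀ n, ‖u n‖ = 1) ∧ WeakStarNull u := by
  obtain ⟨u, hu, hle⟩ := JosefsonNissenzweig.exists_normalized hc hy
  refine ⟨u, hu, fun x => squeeze_zero_norm (hle · x) ?_⟩
  simpa using ((h x).norm.const_mul c⁻¹)

theorem WeakStarEllTwo.exists_normalized {y : ℕ → StrongDual 𝕜 X} (h : WeakStarEllTwo y) {c : ℝ}
    (hc : 0 < c) (hy : ∀ n, c ≤ ‖y n‖) :
    ∃ u : ℕ → StrongDual 𝕜 X, (∀ n, ‖u n‖ = 1) ∧ WeakStarEllTwo u := by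
  obtain ⟨u, hu, hle⟩ := JosefsonNissenzweig.exists_normalized hc hy
  refine ⟨u, hu, fun x => Summable.of_nonneg_of_le (fun _ => by positivity) (fun n => ?_)
    ((h x).mul_left (c⁻¹ ^ 2))⟩
  rw [← mul_pow]
  exact pow_le_pow_left₀ (norm_nonneg _) (hle n x) 2

theorem WeakStarEllTwo.weakStarNull {y : ℕ → StrongDual 𝕜 X} (h : WeakStarEllTwo y) :
    WeakStarNull y := fun x => by
  have h1 := (h x).tendsto_atTop_zero
  rw [tendsto_zero_iff_norm_tendsto_zero]
  have h2 := h1.sqrt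
  simpa [Real.sqrt_sq] using h2

theorem exists_normalized_weakStarEllTwo {y : ℕ → StrongDual 𝕜 X} {R : ℝ}
    (hR : ∀ i, ‖y i‖ ≤ R) (hnull : ∀ z, IsBlocking 𝕜 y z → ¬ WeakStarNull z) :
    ∃ u : ℕ → StrongDual 𝕜 X, (∀ n, ‖u n‖ = 1) ∧ WeakStarEllTwo u := by
  obtain ⟨z, c, -, hc, h⟩ := exists_blocking_rademacherAverage hR hnull
  obtain ⟨L, hL⟩ := exists_isBanachLimit 𝕜
  obtain ⟨w, -, hw, hw2⟩ := h L hL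
  exact hw2.exists_normalized hc hw

/-- A finite-dimensional dual has a finite-dimensional dual, into which `X` embeds. -/
theorem not_finiteDimensional_strongDual (h : ¬ FiniteDimensional 𝕜 X) :
    ¬ FiniteDimensional 𝕜 (StrongDual 𝕜 X) := fun _ => h <|
  have : FiniteDimensional 𝕜 (StrongDual 𝕜 (StrongDual 𝕜 X)) := inferInstance
  FiniteDimensional.of_injective
    (NormedSpace.inclusionInDoubleDualLi (E := X) 𝕜).toLinearMap
    (NormedSpace.inclusionInDoubleDualLi (E := X) 𝕜).injective

theorem exists_normalized_weakStarNull (h : ¬ FiniteDimensional 𝕜 X) :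
    ∃ u : ℕ → StrongDual 𝕜 X, (∀ n, ‖u n‖ = 1) ∧ WeakStarNull u := by
  obtain ⟨R, y, -, hR, hsep⟩ :=
    exists_seq_norm_le_one_le_norm_sub (𝕜 := 𝕜) (not_finiteDimensional_strongDual h)
  obtain ⟨φ, hφ, hlim | hbasis⟩ := exists_tendsto_or_isEllOneBasis hR
  -- Pointwise convergence alone suffices: the limits cancel in the differences, whose norms are at
  -- least 1 by separation.
  · have hdiff : WeakStarNull fun n => y (φ (n + 1)) - y (φ n) := fun x => by
      obtain ⟨l, hl⟩ := hlim x
      simpa using (hl.comp (tendsto_add_atTop_nat 1)).sub hl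
    exact hdiff.exists_normalized one_pos fun n => hsep (hφ n.lt_succ_self).ne'
  · by_cases H : ∃ z, IsBlocking 𝕜 (y ∘ φ) z ∧ WeakStarNull z
    · obtain ⟨z, hz, hznull⟩ := H
      obtain ⟨c, hc, hle⟩ := hbasis.exists_le_norm_of_isBlocking
      exact hznull.exists_normalized hc (hle z hz)
    · push Not at H
      obtain ⟨u, hu, hu2⟩ := exists_normalized_weakStarEllTwo (fun i => hR (φ i)) H
      exact ⟨u, hu, hu2.weakStarNull⟩

end Main

end JosefsonNissenzweig

theorem theorem6p1 {𝕜 : Type*} [RCLike 𝕜] {X : Type*} [NormedAddCommGroup X]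
    [NormedSpace 𝕜 X] [CompleteSpace X] :
    (¬ FiniteDimensional 𝕜 X →
      ∃ x' : ℕ → StrongDual 𝕜 X, (∀ n, ‖x' n‖ = 1) ∧ JosefsonNissenzweig.WeakStarNull x') ∧
    (∀ x' : ℕ → StrongDual 𝕜 X,
      JosefsonNissenzweig.IsEllOneBasis 𝕜 x' →
      (∀ y' : ℕ → StrongDual 𝕜 X, JosefsonNissenzweig.IsBlocking 𝕜 x' y' →
        ¬ JosefsonNissenzweig.WeakStarNull y') →
      (∃ (z' : ℕ → StrongDual 𝕜 X) (c : ℝ), JosefsonNissenzweig.IsBlocking 𝕜 x' z' ∧ 0 < c ∧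
        ∀ L : StrongDual 𝕜 (lp (fun _ : ℕ => 𝕜) ∞), JosefsonNissenzweig.IsBanachLimit L →
          ∃ w' : ℕ → StrongDual 𝕜 X, JosefsonNissenzweig.IsRademacherAverage L z' w' ∧
            (∀ n, c ≤ ‖w' n‖) ∧ JosefsonNissenzweig.WeakStarEllTwo w') ∧
      ∃ u' : ℕ → StrongDual 𝕜 X, (∀ n, ‖u' n‖ = 1) ∧
        JosefsonNissenzweig.WeakStarEllTwo u') := by
  refine ⟨JosefsonNissenzweig.exists_normalized_weakStarNull, fun x' hx' hnull => ?_⟩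
  obtain ⟨R, hR⟩ := hx'.exists_norm_le
  exact ⟨JosefsonNissenzweig.exists_blocking_rademacherAverage hR hnull,
    JosefsonNissenzweig.exists_normalized_weakStarEllTwo hR hnull⟩
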